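/- Let $K$ be a field and $n\ge 1$. Let $Q_n$ be the quiver with vertices $1,\dots,n$ (read modulo $n$) and one arrow $x_i\colon i\to i+1$ for each vertex $i$, so $Q_n$ is a single oriented $n$-cycle. Let $\Lambda=KQ_n/I$ be a Nakayama algebra of order $n$: here $KQ_n$ is the path algebra (paths multiplied from left to right) and $I$ is the two-sided ideal generated by a finite non-empty set of paths of length $\ge 1$. (If all of these have length $\ge2$, then $\Lambda$ is a cyclic Nakayama algebra; if some are single arrows, then $\Lambda$ is a linear Nakayama algebra or a product of such.) For each vertex $i$ let $P_i=e_i\Lambda$ be the corresponding indecomposable projective right $\Lambda$-module, $|P_i|$ its length, and $S_i=P_i/\operatorname{rad}P_i$ its simple top. The resolution quiver $R(\Lambda)$ has the same vertices as $Q_n$ and one arrow $i\to j$ whenever the socle of $P_i$ is isomorphic to $S_{j-1}$. The weight of an oriented cycle of $R(\Lambda)$ is $\frac1n\sum|P_i|$, the sum being over the vertices $i$ of the cycle; the weight of a connected component of $R(\Lambda)$ is the weight of the unique oriented cycle that it contains. **Theorem A** (Shen). $\Lambda$ has finite global dimension if and only if $R(\Lambda)$ has exactly one connected component and that component has weight $1$.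 Moreover, for every $\ell\ge1$, the algebra $KQ_n/\mathrm{rad}^\ell$ (the quotient of $KQ_n$ by the ideal generated by all paths of length $\ell$) has finite global dimension if and only if $\ell=1$. -/

import Mathlib

open CategoryTheory

universe u

namespace Nakayama

/-! ### The cyclic quiver and its path algebra -/

/-- A path in the cyclic quiver `Q_n`, whose vertices are the residues modulo `n` and which has one
arrow `x_i : i → i + 1` for every vertex `i`. The path `x_i x_{i+1} ⋯ x_{i+m-1}` (written left to
right) is determined by its starting vertex `i` and its length `m`; for `m = 0` it is the trivial
path at `i`. -/
@[ext] structure CPath (n : ℕ) where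
  /-- the vertex where the path starts -/
  start : ZMod n
  /-- the number of arrows in the path -/
  length : ℕ

/-- The vertex where a path ends. -/
def CPath.target {n : ℕ} (p : CPath n) : ZMod n := p.start + p.length

/-- The path algebra `KQ_n`: the vector space with basis the paths of `Q_n`. -/
def PathAlgebra (K : Type u) [Field K] (n : ℕ) : Type u := CPath n →₀ K

section PathAlgebra

variable (K : Type u) [Field K] (n : ℕ)

noncomputable instance : AddCommGroup (PathAlgebra K n) :=
  inferInstanceAs (AddCommGroup (CPath n →₀ K))

noncomputable instance : Module K (PathAlgebra K n) :=
  inferInstanceAs (Module K (CPath n →₀ K))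

variable {n}

/-- A path, as a basis element of the path algebra. -/
noncomputable def ofPath (p : CPath n) : PathAlgebra K n :=
  (Finsupp.single p (1 : K) : CPath n →₀ K)

/-- The product of two paths: first `p`, then `q`, if `p` ends where `q` starts, and `0`
otherwise. -/
noncomputable def pathMul (p q : CPath n) : PathAlgebra K n :=
  open Classical in
  if p.target = q.start then ofPath K ⟨p.start, p.length + q.length⟩ else 0

/-- The product of the path algebra: the bilinear extension of the product of paths. -/
noncomputable def mulHom : PathAlgebra K n →ₗ[K] PathAlgebra K n →ₗ[K] PathAlgebra K n :=
  Finsupp.linearCombination K fun p =>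
    (Finsupp.linearCombination K (pathMul K p) : (CPath n →₀ K) →ₗ[K] PathAlgebra K n)

noncomputable instance : Mul (PathAlgebra K n) := ⟨fun a b => mulHom K a b⟩

/-- The identity of the path algebra is the sum of the trivial paths. -/
noncomputable instance [NeZero n] : One (PathAlgebra K n) := ⟨∑ i : ZMod n, ofPath K ⟨i, 0⟩⟩

theorem mul_def (a b : PathAlgebra K n) : a * b = mulHom K a b := rfl

theorem one_def [NeZero n] : (1 : PathAlgebra K n) = ∑ i : ZMod n, ofPath K ⟨i, 0⟩ := rfl

theorem mulHom_ofPath (p q : CPath n) : mulHom K (ofPath K p) (ofPath K q) = pathMul K p q := by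
  simp only [mulHom, ofPath]
  erw [Finsupp.linearCombination_single, one_smul, Finsupp.linearCombination_single, one_smul]

/-- Linear maps out of the path algebra are determined by their values on paths. -/
theorem hom_ext {M : Type*} [AddCommMonoid M] [Module K M] {f g : PathAlgebra K n →ₗ[K] M}
    (h : ∀ p, f (ofPath K p) = g (ofPath K p)) : f = g :=
  Finsupp.lhom_ext' fun p => LinearMap.ext_ring (h p)

theorem ofPath_mul (p q : CPath n) : ofPath K p * ofPath K q = pathMul K p q :=
  mulHom_ofPath K p q

theorem mulHom_assoc (a b c : PathAlgebra K n) :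
    mulHom K (mulHom K a b) c = mulHom K a (mulHom K b c) := by
  have h : (mulHom K).compr₂ (mulHom K) =
      ((LinearMap.lcomp K (PathAlgebra K n →ₗ[K] PathAlgebra K n) (mulHom K)).comp
        (LinearMap.llcomp K (PathAlgebra K n) (PathAlgebra K n) (PathAlgebra K n))).comp
          (mulHom K (n := n)) := by
    refine hom_ext K fun p => hom_ext K fun q => hom_ext K fun r => ?_
    simp only [LinearMap.compr₂_apply, LinearMap.comp_apply, LinearMap.lcomp_apply,
      LinearMap.llcomp_apply, mulHom_ofPath, pathMul]
    split_ifs with h1 h2 h2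
    · rw [mulHom_ofPath, mulHom_ofPath, pathMul, pathMul, if_pos, if_pos h1]
      · simp only [add_assoc]
      · simp only [CPath.target] at *
        rw [← h2, ← h1]; push_cast; ring
    · rw [mulHom_ofPath, pathMul, if_neg, map_zero]
      simp only [CPath.target] at *
      intro h3; apply h2; rw [← h3, ← h1]; push_cast; ring
    · rw [mulHom_ofPath, pathMul, if_neg h1]; simp
    · simp
  exact LinearMap.congr_fun (LinearMap.congr_fun (LinearMap.congr_fun h a) b) c

theorem mulHom_one_left [NeZero n] (a : PathAlgebra K n) : mulHom K 1 a = a := by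
  have h : mulHom K (1 : PathAlgebra K n) = LinearMap.id := by
    refine hom_ext K fun p => ?_
    rw [one_def, map_sum, LinearMap.sum_apply, Finset.sum_eq_single p.start]
    · simp [mulHom_ofPath, pathMul, CPath.target]
    · intro i _ hi
      simp [mulHom_ofPath, pathMul, CPath.target, hi]
    · simp
  rw [h]; rfl

theorem mulHom_one_right [NeZero n] (a : PathAlgebra K n) : mulHom K a 1 = a := by
  have h : (mulHom K).flip (1 : PathAlgebra K n) = LinearMap.id := by
    refine hom_ext K fun p => ?_
    rw [LinearMap.flip_apply, one_def, map_sum, Finset.sum_eq_single p.target]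
    · simp [mulHom_ofPath, pathMul]
    · intro i _ hi
      simp [mulHom_ofPath, pathMul, hi.symm]
    · simp
  exact LinearMap.congr_fun h a

noncomputable instance [NeZero n] : Ring (PathAlgebra K n) :=
  { (inferInstance : AddCommGroup (PathAlgebra K n)),
    (inferInstance : Mul (PathAlgebra K n)),
    (inferInstance : One (PathAlgebra K n)) with
    left_distrib := fun a b c => map_add (mulHom K a) b c
    right_distrib := fun a b c => by simp only [mul_def, map_add, LinearMap.add_apply]
    zero_mul := fun a => by simp only [mul_def, map_zero, LinearMap.zero_apply]
    mul_zero := fun a => map_zero (mulHom K a)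
    mul_assoc := mulHom_assoc K
    one_mul := mulHom_one_left K
    mul_one := mulHom_one_right K }

noncomputable instance [NeZero n] : Algebra K (PathAlgebra K n) :=
  Algebra.ofModule
    (fun r a b => by simp only [mul_def, map_smul, LinearMap.smul_apply])
    (fun r a b => by simp only [mul_def, map_smul])

end PathAlgebra

/-! ### Nakayama algebras and their modules -/

section Algebra

variable (K : Type u) [Field K] {n : ℕ} [NeZero n]

/-- The two-sided ideal `I` of `KQ_n` generated by a set of paths. -/
noncomputable def relIdeal (Y : Set (CPath n)) : TwoSidedIdeal (PathAlgebra K n) :=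
  TwoSidedIdeal.span (ofPath K '' Y)

/-- The algebra `Λ = KQ_n / I`, where `I` is generated by the paths in `Y`. -/
abbrev Alg (Y : Set (CPath n)) : Type u := (relIdeal K Y).ringCon.Quotient

variable (Y : Set (CPath n))

/-- The idempotent `e_i` of `Λ`, the class of the trivial path at the vertex `i`. -/
noncomputable def idem (i : ZMod n) : Alg K Y := (relIdeal K Y).ringCon.mk' (ofPath K ⟨i, 0⟩)

/-- The indecomposable projective right module `P_i = e_i Λ`. Right modules over `Λ` are modules
over the opposite ring. -/
noncomputable abbrev proj (i : ZMod n) : Submodule (Alg K Y)ᵐᵒᵖ (Alg K Y) :=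
  Submodule.span (Alg K Y)ᵐᵒᵖ {idem K Y i}

/-- The simple right module `S_i` at the vertex `i`, the top `P_i / rad P_i` of `P_i`. -/
abbrev simpleMod (i : ZMod n) : Type u :=
  proj K Y i ⧸ Module.jacobson (Alg K Y)ᵐᵒᵖ (proj K Y i)

/-- The length `|P_i|` of `P_i`, as a natural number (`P_i` has finite length as soon as there is
at least one relation). -/
noncomputable def projLength (i : ZMod n) : ℕ :=
  (Module.length (Alg K Y)ᵐᵒᵖ (proj K Y i)).toNat

end Algebra

/-- The socle of a module: the sum of its simple submodules. -/
def socle (R M : Type*) [Ring R] [AddCommGroup M] [Module R M] : Submodule R M :=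
  sSup {N : Submodule R M | IsSimpleModule R N}

/-- The global dimension of the module category of `R` is finite: the projective dimensions of all
(left) `R`-modules have a common finite bound. -/
def HasFiniteGlobalDimension (R : Type u) [Ring R] : Prop :=
  ∃ d : ℕ, ∀ M : ModuleCat.{u} R, HasProjectiveDimensionLE M d

/-! ### The resolution quiver -/

section ResolutionQuiver

variable (K : Type u) [Field K] {n : ℕ} [NeZero n] (Y : Set (CPath n))

/-- The vertices of the resolution quiver `R(Λ)` are those of `Q_n`. -/
def ResolutionQuiver (_Y : Set (CPath n)) (_K : Type u) [Field _K] : Type := ZMod n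

/-- There is an arrow `i → j` in `R(Λ)` if the socle of `P_i` is isomorphic to `S_{j-1}`. -/
def IsArrow (i j : ZMod n) : Prop :=
  Nonempty (socle (Alg K Y)ᵐᵒᵖ (proj K Y i) ≃ₗ[(Alg K Y)ᵐᵒᵖ] simpleMod K Y (j - 1))

instance : Quiver (ResolutionQuiver Y K) where
  Hom i j := PLift (IsArrow K Y i j)

/-- The components of the resolution quiver: two vertices are in the same component if they are
joined by a sequence of arrows, which may be traversed in either direction. -/
abbrev Component : Type := Quiver.WeaklyConnectedComponent (ResolutionQuiver Y K)

/-- The component of a vertex. -/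
def componentOf (i : ZMod n) : Component K Y :=
  Quiver.WeaklyConnectedComponent.mk (V := ResolutionQuiver Y K) i

/-- Oriented cycles of the resolution quiver: non-empty cyclic sequences of distinct vertices with
an arrow from each vertex to the next one (and from the last vertex to the first). A loop is an
oriented cycle with one vertex. -/
def IsOrientedCycle (c : Cycle (ZMod n)) : Prop :=
  c ≠ Cycle.nil ∧ c.Nodup ∧ c.Chain (IsArrow K Y)

/-- The weight of an oriented cycle: the sum of the lengths `|P_i|` over the vertices `i` of the
cycle, divided by `n`. -/
noncomputable def cycleWeight (c : Cycle (ZMod n)) : ℚ :=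
  ((c.toMultiset.map (projLength K Y)).sum : ℚ) / n

/-- A component has weight `w` if it contains an oriented cycle and the oriented cycles in it
have weight `w`. (A component contains in fact exactly one oriented cycle.) -/
def HasWeight (C : Component K Y) (w : ℚ) : Prop :=
  (∃ c, IsOrientedCycle K Y c ∧ ∀ i ∈ c, componentOf K Y i = C) ∧
    ∀ c, IsOrientedCycle K Y c → (∀ i ∈ c, componentOf K Y i = C) → cycleWeight K Y c = w

end ResolutionQuiver

end Nakayama

/-! Write c(i) = |P_i|. A right ideal generated by a path of length m starting at i has projective
cover P_{i+m}, with kernel generated by the path of length c(i) - m starting at i+m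
(`ker_pathMulLeft`). Up to isomorphism, taking syzygies is therefore the combinatorial map `syz` on
pairs (i, m), and length 0 means the projective P_i itself. Since Λ is artinian and has finitely
many simple modules, Λ has finite global dimension iff the `syz`-orbit of every (i, 1), which stands
for rad P_i, reaches length 0 (`hasFiniteGlobalDimension_iff`).

The arrows of R(Λ) are i → i + c(i) (`isArrow_iff`). Lift this map to F(x) = x + c(x) on ℤ; the
inequality c(i) ≤ c(i+1) + 1 says that F is monotone. Read (i, m) as an interval [x, y]. One syzygy
gives [y, Fx], two give [Fx, Fy]. So the orbit of [x, x+1] reaches length 0 iff, for some k,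
F^k(x+1) is F^k(x) or F^{k+1}(x) (`exists_syz_iterate_iff`).

If this holds for all x, any two forward orbits in ℤ merge. Modulo n this gives connectedness;
merging x with x + n forces the cycle to wind around ℤ/n exactly once, which is weight 1.
Conversely, let R(Λ) be connected of weight 1. For large k both w = F^k(x) and v = F^k(x+1) lift
periodic vertices, and w ≤ v ≤ Fw. The orbit of w contains every lift of a periodic vertex above w
and skips the integers strictly between w and Fw, so v is w or Fw (`eq_or_eq_of_periodic`). -/

namespace Nakayama

/-! ### Dynamics of a Kupisch series -/

section Kupisch

open Function

variable {n : ℕ}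

/-- A Kupisch series: the sequence of the lengths of the indecomposable projective modules of a
Nakayama algebra. -/
structure IsKupisch (c : ZMod n → ℕ) : Prop where
  pos : ∀ i, 1 ≤ c i
  le_succ : ∀ i, c i ≤ c (i + 1) + 1

/-- The map on vertices whose graph is the resolution quiver. -/
def nextVertex (c : ZMod n → ℕ) (i : ZMod n) : ZMod n := i + (c i : ZMod n)

/-- The lift of `nextVertex` to the universal cover. -/
def nextLift (c : ZMod n → ℕ) (x : ℤ) : ℤ := x + (c (x : ZMod n) : ℤ)

/-- The effect of taking a syzygy on right ideals generated by a path, in terms of the starting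
vertex and the length of the path. -/
def syz (c : ZMod n → ℕ) (p : ZMod n × ℕ) : ZMod n × ℕ := (p.1 + (p.2 : ZMod n), c p.1 - p.2)

variable {c : ZMod n → ℕ}

/-- Equivalently c(i) - m ≤ c(i+m): a syzygy is again given by a path that fits into its projective.
-/
theorem IsKupisch.le_add (hc : IsKupisch c) (i : ZMod n) (m : ℕ) :
    c i ≤ c (i + (m : ZMod n)) + m := by
  induction m with
  | zero => simp
  | succ m ih =>
    have := hc.le_succ (i + (m : ZMod n))
    rw [add_assoc, ← Nat.cast_add_one] at this
    omega

theorem coe_nextLift (x : ℤ) : ((nextLift c x : ℤ) : ZMod n) = nextVertex c (x : ZMod n) := by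
  simp [nextLift, nextVertex]

theorem coe_nextLift_iterate (k : ℕ) (x : ℤ) :
    (((nextLift c)^[k] x : ℤ) : ZMod n) = (nextVertex c)^[k] (x : ZMod n) :=
  (Semiconj.iterate_right (f := fun x : ℤ => (x : ZMod n)) (fun x => coe_nextLift x) k).eq x

theorem nextLift_iterate_add_mul (k : ℕ) (x t : ℤ) :
    (nextLift c)^[k] (x + t * n) = (nextLift c)^[k] x + t * n := by
  have h : Function.Commute (nextLift c) (fun x : ℤ => x + t * n) := fun x => by
    simp only [nextLift]; push_cast; rw [ZMod.natCast_self, mul_zero, add_zero]; ring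
  exact (h.iterate_left k).eq x

theorem nextLift_iterate_sub (k : ℕ) (x : ℤ) :
    (nextLift c)^[k] x - x = ∑ j ∈ Finset.range k, (c ((nextVertex c)^[j] (x : ZMod n)) : ℤ) := by
  induction k with
  | zero => simp
  | succ k ih =>
    rw [Finset.sum_range_succ, ← ih, iterate_succ_apply', ← coe_nextLift_iterate]
    simp only [nextLift]; ring

/-- In interval form: [x, y] goes to [y, Fx]. The truncation by `toNat` matches the natural
subtraction in `syz`, so y may exceed Fx. -/
theorem syz_coe {x y : ℤ} (h : x ≤ y) :
    syz c ((x : ZMod n), (y - x).toNat) = ((y : ZMod n), (nextLift c x - y).toNat) := by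
  have h1 : ((y - x).toNat : ℤ) = y - x := Int.toNat_of_nonneg (by omega)
  have h2 : (((y - x).toNat : ℕ) : ZMod n) = (y : ZMod n) - x := by
    rw [← Int.cast_natCast, h1]; push_cast; rfl
  simp only [syz, h2, nextLift, Prod.mk.injEq]
  exact ⟨by ring, by omega⟩

theorem exists_iterate_mem_periodicPts {α : Type*} [Finite α] (f : α → α) (i : α) :
    ∃ k, f^[k] i ∈ periodicPts f := by
  obtain ⟨a, b, hab, h⟩ := Finite.exists_ne_map_eq_of_infinite fun k => f^[k] i
  wlog hlt : a < b generalizing a b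
  · exact this b a hab.symm h.symm (by omega)
  refine ⟨a, b - a, by omega, ?_⟩
  rw [IsPeriodicPt, IsFixedPt, ← iterate_add_apply, Nat.sub_add_cancel hlt.le]
  exact h.symm

/-- If consecutive integers merge up to a shift, then so do arbitrary ones. -/
theorem exists_iterate_add_eq
    (H : ∀ x : ℤ, ∃ k, (nextLift c)^[k] (x + 1) = (nextLift c)^[k] x ∨
        (nextLift c)^[k] (x + 1) = (nextLift c)^[k + 1] x) (x : ℤ) (N : ℕ) :
    ∃ k j, (nextLift c)^[k] (x + N) = (nextLift c)^[k + j] x := by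
  induction N with
  | zero => exact ⟨0, 0, by simp⟩
  | succ N ih =>
    obtain ⟨k, j, h⟩ := ih
    obtain ⟨l, hl⟩ : ∃ l, ∃ e, (nextLift c)^[l] (x + N + 1) = (nextLift c)^[l + e] (x + N) := by
      obtain ⟨l, hl | hl⟩ := H (x + N)
      exacts [⟨l, 0, hl⟩, ⟨l, 1, hl⟩]
    obtain ⟨e, hl⟩ := hl
    refine ⟨k + l, j + e, ?_⟩
    rw [Nat.cast_succ, ← add_assoc, iterate_add_apply, hl, ← iterate_add_apply,
      show k + (l + e) = (l + e) + k by ring, iterate_add_apply, h, ← iterate_add_apply]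
    congr 1
    ring

/-- On lifts of a, F^m is translation by a multiple s·n, where m is the period. The merging
hypothesis yields F^j(a) = a + n; then j = q·m and q·s = 1, so s = 1. -/
theorem nextLift_iterate_minimalPeriod [NeZero n] {a : ℤ}
    (ha : (a : ZMod n) ∈ periodicPts (nextVertex c)) {x : ℤ} {k j : ℕ}
    (hx : (x : ZMod n) = (a : ZMod n))
    (h : (nextLift c)^[k] (x + n) = (nextLift c)^[k + j] x) :
    (nextLift c)^[minimalPeriod (nextVertex c) (a : ZMod n)] a = a + n := by
  set m := minimalPeriod (nextVertex c) (a : ZMod n) with hm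
  have hn : (0 : ℤ) < n := by exact_mod_cast Nat.pos_of_ne_zero (NeZero.ne n)
  have hmpos : 0 < m := minimalPeriod_pos_of_mem_periodicPts ha
  have key : ∀ w : ℤ, (w : ZMod n) = (a : ZMod n) → ∀ l, ∃ s : ℤ,
      (nextLift c)^[m * l] w = w + s * n := by
    intro w hw l
    have h1 : (((nextLift c)^[m * l] w : ℤ) : ZMod n) = (w : ZMod n) := by
      rw [coe_nextLift_iterate, hw]
      exact (isPeriodicPt_minimalPeriod _ _).mul_const l
    rw [eq_comm, ZMod.intCast_eq_intCast_iff_dvd_sub] at h1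
    obtain ⟨s, hs⟩ := h1
    exact ⟨s, by linarith [mul_comm s (n : ℤ)]⟩
  have hj : (nextLift c)^[j] a = a + n := by
    obtain ⟨s, hs⟩ := key x hx k
    obtain ⟨t, ht⟩ : ∃ t : ℤ, x = a + t * n := by
      rw [eq_comm, ZMod.intCast_eq_intCast_iff_dvd_sub] at hx
      obtain ⟨s, hs⟩ := hx
      exact ⟨s, by linarith [mul_comm s (n : ℤ)]⟩
    -- Padding k to the multiple m·k of the period makes the common iterate a translation on lifts
    -- of a, so it can be cancelled.
    have h2 : (nextLift c)^[m * k] (x + n) = (nextLift c)^[m * k] ((nextLift c)^[j] x) := by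
      obtain ⟨d, hd⟩ : ∃ d, m * k = d + k :=
        ⟨m * k - k, by have := Nat.le_mul_of_pos_left k hmpos; omega⟩
      rw [hd, iterate_add_apply, h, ← iterate_add_apply, ← iterate_add_apply]
      congr 1; ring
    have h3 := nextLift_iterate_add_mul (c := c) (m * k) x 1
    rw [one_mul, h2, ← iterate_add_apply, add_comm, iterate_add_apply, hs,
      nextLift_iterate_add_mul, ht, nextLift_iterate_add_mul] at h3
    linarith
  have hper : IsPeriodicPt (nextVertex c) j (a : ZMod n) := by
    rw [IsPeriodicPt, IsFixedPt, ← coe_nextLift_iterate, hj]; simp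
  obtain ⟨q, hq⟩ := hper.minimalPeriod_dvd
  rw [← hm] at hq
  obtain ⟨s, hs⟩ := key a rfl 1
  rw [mul_one] at hs
  have hpow : ∀ q : ℕ, (nextLift c)^[m * q] a = a + q * s * n := by
    intro q
    induction q with
    | zero => simp
    | succ q ih =>
      rw [Nat.mul_succ, add_comm, iterate_add_apply, ih, nextLift_iterate_add_mul, hs]
      push_cast; ring
  have h4 := hpow q
  rw [← hq, hj] at h4
  have h5 : (q : ℤ) * s = 1 := by
    have : ((q : ℤ) * s) * n = 1 * n := by linarith
    exact mul_right_cancel₀ hn.ne' this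
  have h6 : s = 1 := by
    rcases Int.isUnit_iff.1 (IsUnit.of_mul_eq_one_right _ h5) with h | h
    · exact h
    · rw [h] at h5; omega
  rw [hs, h6, one_mul]

namespace IsKupisch

variable (hc : IsKupisch c)
include hc

theorem lt_nextLift (x : ℤ) : x < nextLift c x := by
  have := hc.pos (x : ZMod n)
  simp only [nextLift]; omega

theorem monotone_nextLift : Monotone (nextLift c) := by
  refine monotone_int_of_le_succ fun x => ?_
  have := hc.le_succ (x : ZMod n)
  simp only [nextLift]; push_cast; omega

theorem strictMono_iterate (x : ℤ) : StrictMono fun k : ℕ => (nextLift c)^[k] x :=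
  strictMono_nat_of_lt_succ fun k => by
    simp only [iterate_succ_apply']; exact hc.lt_nextLift _

/-- The two orbits interlace forever, so all interval lengths below are nonnegative and `toNat`
loses nothing. -/
theorem iterate_le_iterate {x y : ℤ} (h : x ≤ y) (h' : y ≤ nextLift c x) (k : ℕ) :
    (nextLift c)^[k] x ≤ (nextLift c)^[k] y ∧ (nextLift c)^[k] y ≤ (nextLift c)^[k + 1] x :=
  ⟨hc.monotone_nextLift.iterate k h, by
    rw [iterate_succ_apply]; exact hc.monotone_nextLift.iterate k h'⟩

theorem syz_iterate_even {x y : ℤ} (h : x ≤ y) (h' : y ≤ nextLift c x) (k : ℕ) :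
    (syz c)^[2 * k] ((x : ZMod n), (y - x).toNat) =
      ((((nextLift c)^[k] x : ℤ) : ZMod n), ((nextLift c)^[k] y - (nextLift c)^[k] x).toNat) := by
  induction k with
  | zero => rfl
  | succ k ih =>
    obtain ⟨h1, h2⟩ := hc.iterate_le_iterate h h' k
    rw [show 2 * (k + 1) = 2 * k + 1 + 1 from rfl, iterate_succ_apply', iterate_succ_apply', ih,
      syz_coe h1, ← iterate_succ_apply' (nextLift c), syz_coe h2,
      ← iterate_succ_apply' (nextLift c)]

theorem syz_iterate_odd {x y : ℤ} (h : x ≤ y) (h' : y ≤ nextLift c x) (k : ℕ) :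
    (syz c)^[2 * k + 1] ((x : ZMod n), (y - x).toNat) =
      ((((nextLift c)^[k] y : ℤ) : ZMod n), ((nextLift c)^[k + 1] x - (nextLift c)^[k] y).toNat) := by
  rw [iterate_succ_apply', hc.syz_iterate_even h h', syz_coe (hc.iterate_le_iterate h h' k).1,
    ← iterate_succ_apply' (nextLift c)]

theorem exists_syz_iterate_iff (x : ℤ) :
    (∃ k, ((syz c)^[k] ((x : ZMod n), 1)).2 = 0) ↔
      ∃ k, (nextLift c)^[k] (x + 1) = (nextLift c)^[k] x ∨
        (nextLift c)^[k] (x + 1) = (nextLift c)^[k + 1] x := by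
  have h : x ≤ x + 1 := by omega
  have h' : x + 1 ≤ nextLift c x := hc.lt_nextLift x
  have h1 : ((x : ZMod n), 1) = ((x : ZMod n), (x + 1 - x).toNat) := by simp
  rw [h1]
  constructor
  · rintro ⟨k, hk⟩
    obtain ⟨j, rfl | rfl⟩ := Nat.even_or_odd' k
    · rw [hc.syz_iterate_even h h'] at hk
      have := (hc.iterate_le_iterate h h' j).1
      exact ⟨j, Or.inl (by simp only at hk; omega)⟩
    · rw [hc.syz_iterate_odd h h'] at hk
      have := (hc.iterate_le_iterate h h' j).2
      exact ⟨j, Or.inr (by simp only at hk; omega)⟩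
  · rintro ⟨k, hk | hk⟩
    · exact ⟨2 * k, by rw [hc.syz_iterate_even h h', hk]; simp⟩
    · exact ⟨2 * k + 1, by rw [hc.syz_iterate_odd h h', hk]; simp⟩

/-- On the universal cover, the orbit of a lift of a periodic vertex contains all lifts of periodic
vertices above it, as soon as the cycle winds around once and is unique. -/
theorem eq_or_eq_of_periodic [NeZero n] {w v : ℤ}
    (hv : (v : ZMod n) ∈ periodicPts (nextVertex c))
    (hconn : ∃ k l, (nextVertex c)^[k] (w : ZMod n) = (nextVertex c)^[l] (v : ZMod n))
    (hone : (nextLift c)^[minimalPeriod (nextVertex c) (w : ZMod n)] w = w + n)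
    (h1 : w ≤ v) (h2 : v ≤ nextLift c w) : v = w ∨ v = nextLift c w := by
  set m := minimalPeriod (nextVertex c) (w : ZMod n)
  have hpow : ∀ q : ℕ, (nextLift c)^[m * q] w = w + q * n := by
    intro q
    induction q with
    | zero => simp
    | succ q ih =>
      rw [Nat.mul_succ, add_comm, iterate_add_apply, ih, nextLift_iterate_add_mul, hone]
      push_cast; ring
  -- The orbits of w and v meet; as v is periodic, going on around its cycle reaches v itself.
  obtain ⟨a, ha⟩ : ∃ a, (nextVertex c)^[a] (w : ZMod n) = (v : ZMod n) := by
    obtain ⟨k, l, hkl⟩ := hconn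
    obtain ⟨p, hp, hp'⟩ := hv
    refine ⟨p * l - l + k, ?_⟩
    have : l ≤ p * l := Nat.le_mul_of_pos_left l hp
    rw [iterate_add_apply, hkl, ← iterate_add_apply, Nat.sub_add_cancel this]
    exact hp'.mul_const l
  rw [← coe_nextLift_iterate, ZMod.intCast_eq_intCast_iff_dvd_sub] at ha
  obtain ⟨t, ht⟩ := ha
  -- v and F^a(w) differ by t·n with t of unknown sign. Translating by |t|·n makes the number of
  -- extra turns nonnegative, hence realisable by iterating F.
  have hs : v + t.natAbs * n = (nextLift c)^[m * (t + t.natAbs).toNat + a] w := by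
    have h3 : ((t + t.natAbs).toNat : ℤ) = t + t.natAbs := Int.toNat_of_nonneg (by omega)
    rw [add_comm (m * _), iterate_add_apply, hpow, h3, nextLift_iterate_add_mul]
    linarith [mul_comm (n : ℤ) t]
  set b := m * (t + t.natAbs).toNat + a
  -- The translate of v lies between two consecutive points of the strictly increasing orbit of w,
  -- so it is one of them.
  have h3 : (nextLift c)^[m * t.natAbs] w ≤ (nextLift c)^[b] w := by
    rw [hpow, ← hs]; linarith
  have h4 : (nextLift c)^[b] w ≤ (nextLift c)^[m * t.natAbs + 1] w := by
    rw [add_comm (m * t.natAbs), iterate_add_apply _ 1, hpow, ← hs, iterate_one]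
    have := nextLift_iterate_add_mul (c := c) 1 w t.natAbs
    rw [iterate_one] at this
    linarith
  have h5 := (hc.strictMono_iterate w).le_iff_le.1 h3
  have h6 := (hc.strictMono_iterate w).le_iff_le.1 h4
  rcases (show b = m * t.natAbs ∨ b = m * t.natAbs + 1 by omega) with h | h
  · left
    rw [h, hpow] at hs
    linarith
  · right
    have := nextLift_iterate_add_mul (c := c) 1 w t.natAbs
    rw [h, add_comm (m * t.natAbs), iterate_add_apply, hpow, this, iterate_one] at hs
    linarith

/-- Every syzygy sequence terminates if and only if `nextVertex` has exactly one cycle and this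
cycle has weight `1`. -/
theorem forall_exists_syz_iff [NeZero n] :
    (∀ i, ∃ k, ((syz c)^[k] (i, 1)).2 = 0) ↔
      (∀ i j, ∃ k l, (nextVertex c)^[k] i = (nextVertex c)^[l] j) ∧
      ∀ i ∈ periodicPts (nextVertex c),
        ∑ j ∈ Finset.range (minimalPeriod (nextVertex c) i), c ((nextVertex c)^[j] i) = n := by
  constructor
  · intro H
    have H1 := exists_iterate_add_eq fun x =>
      (hc.exists_syz_iterate_iff x).1 (H (x : ZMod n))
    constructor
    · intro i j
      obtain ⟨k, l, h⟩ := H1 (i.cast : ℤ) (j - i).val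
      refine ⟨k + l, k, ?_⟩
      have h2 := congrArg (fun x : ℤ => (x : ZMod n)) h
      simp only [coe_nextLift_iterate] at h2
      push_cast at h2
      simpa using h2.symm
    · intro i hi
      obtain ⟨k, l, h⟩ := H1 (i.cast : ℤ) n
      have hi' : (((i.cast : ℤ) : ℤ) : ZMod n) = i := by simp
      have h2 := nextLift_iterate_minimalPeriod (a := (i.cast : ℤ)) (by rwa [hi']) rfl h
      have h3 := nextLift_iterate_sub (c := c) (minimalPeriod (nextVertex c) i) (i.cast : ℤ)
      rw [hi'] at h2 h3
      rw [h2] at h3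
      have h4 : (∑ j ∈ Finset.range (minimalPeriod (nextVertex c) i),
          (c ((nextVertex c)^[j] i) : ℤ)) = n := by linarith
      exact_mod_cast h4
  · rintro ⟨hconn, hwt⟩ i
    have hi' : (((i.cast : ℤ) : ℤ) : ZMod n) = i := by simp
    set x : ℤ := i.cast
    rw [← hi', hc.exists_syz_iterate_iff]
    -- After k + l steps the orbits of both x and x + 1 are on cycles.
    obtain ⟨k, hk⟩ := exists_iterate_mem_periodicPts (nextVertex c) (x : ZMod n)
    obtain ⟨l, hl⟩ := exists_iterate_mem_periodicPts (nextVertex c) ((x + 1 : ℤ) : ZMod n)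
    have up : ∀ (j : ℕ) (z : ZMod n), z ∈ periodicPts (nextVertex c) →
        (nextVertex c)^[j] z ∈ periodicPts (nextVertex c) := fun j z ⟨p, hp, h⟩ =>
      ⟨p, hp, h.apply_iterate j⟩
    have hk' := up l _ hk
    have hl' := up k _ hl
    rw [← iterate_add_apply, ← coe_nextLift_iterate] at hk' hl'
    rw [add_comm] at hk'
    refine ⟨k + l, ?_⟩
    rw [iterate_succ_apply']
    obtain ⟨h1, h2⟩ := hc.iterate_le_iterate (show x ≤ x + 1 by omega) (hc.lt_nextLift x) (k + l)
    rw [iterate_succ_apply'] at h2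
    refine hc.eq_or_eq_of_periodic hl' (hconn _ _) ?_ h1 h2
    have h3 := nextLift_iterate_sub (c := c)
      (minimalPeriod (nextVertex c) (((nextLift c)^[k + l] x : ℤ) : ZMod n))
      ((nextLift c)^[k + l] x)
    have h4 := hwt _ hk'
    have h5 : (∑ j ∈ Finset.range (minimalPeriod (nextVertex c)
        (((nextLift c)^[k + l] x : ℤ) : ZMod n)),
        (c ((nextVertex c)^[j] (((nextLift c)^[k + l] x : ℤ) : ZMod n)) : ℤ)) = n := by
      exact_mod_cast h4
    rw [h5] at h3
    linarith

end IsKupisch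

end Kupisch

/-! ### A basis of a Nakayama algebra -/

section Basis

variable (K : Type u) [Field K] {n : ℕ} [NeZero n] (Y : Set (CPath n))

/-- The paths that contain a path in `Y`. -/
def IsZeroPath {n : ℕ} (Y : Set (CPath n)) (p : CPath n) : Prop :=
  ∃ y ∈ Y, ∃ a b : ℕ, p.length = a + y.length + b ∧ y.start = p.start + (a : ZMod n)

/-- The length of the shortest path starting at `i` that vanishes in `Λ`. -/
noncomputable def kupisch {n : ℕ} (Y : Set (CPath n)) (i : ZMod n) : ℕ :=
  sInf {m | IsZeroPath Y ⟨i, m⟩}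

theorem IsZeroPath.mono {n : ℕ} {Y : Set (CPath n)} {i : ZMod n} {m m' : ℕ}
    (h : IsZeroPath Y ⟨i, m⟩) (hm : m ≤ m') : IsZeroPath Y ⟨i, m'⟩ := by
  obtain ⟨y, hy, a, b, h1, h2⟩ := h
  exact ⟨y, hy, a, b + (m' - m), by simp only at h1 ⊢; omega, h2⟩

theorem exists_isZeroPath {Y : Set (CPath n)} (hY : Y.Nonempty) (i : ZMod n) :
    ∃ m, IsZeroPath Y ⟨i, m⟩ := by
  obtain ⟨y, hy⟩ := hY
  exact ⟨(y.start - i).val + y.length, y, hy, (y.start - i).val, 0, by simp, by simp⟩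

theorem isZeroPath_iff {Y : Set (CPath n)} (hY : Y.Nonempty) {i : ZMod n} {m : ℕ} :
    IsZeroPath Y ⟨i, m⟩ ↔ kupisch Y i ≤ m :=
  ⟨fun h => Nat.sInf_le h, fun h =>
    IsZeroPath.mono (m := kupisch Y i) (Nat.sInf_mem (exists_isZeroPath hY i)) h⟩

theorem isKupisch_kupisch {Y : Set (CPath n)} (hY : Y.Nonempty) (hpos : ∀ y ∈ Y, 1 ≤ y.length) :
    IsKupisch (kupisch Y) where
  pos i := by
    obtain ⟨y, hy, a, b, h1, -⟩ := (isZeroPath_iff hY (i := i)).2 le_rfl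
    have := hpos y hy
    simp only at h1
    omega
  le_succ i := by
    obtain ⟨y, hy, a, b, h1, h2⟩ := (isZeroPath_iff hY (i := i + 1)).2 le_rfl
    refine (isZeroPath_iff hY).1 ⟨y, hy, a + 1, b, ?_, ?_⟩
    · simp only at h1 ⊢; omega
    · rw [h2]; push_cast; ring

/-! ### The relation ideal as a span of paths -/

theorem IsZeroPath.pathMul_left {Y : Set (CPath n)} {q : CPath n} (hq : IsZeroPath Y q)
    (p : CPath n) :
    pathMul K p q ∈ Submodule.span K (ofPath K '' {p | IsZeroPath Y p}) := by
  unfold pathMul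
  split_ifs with h
  · refine Submodule.subset_span ⟨_, ?_, rfl⟩
    obtain ⟨y, hy, a, b, h1, h2⟩ := hq
    refine ⟨y, hy, p.length + a, b, by simp only [h1]; ring, ?_⟩
    rw [h2, ← h, CPath.target]; push_cast; ring
  · exact zero_mem _

theorem IsZeroPath.pathMul_right {Y : Set (CPath n)} {p : CPath n} (hp : IsZeroPath Y p)
    (q : CPath n) :
    pathMul K p q ∈ Submodule.span K (ofPath K '' {p | IsZeroPath Y p}) := by
  unfold pathMul
  split_ifs with h
  · refine Submodule.subset_span ⟨_, ?_, rfl⟩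
    obtain ⟨y, hy, a, b, h1, h2⟩ := hp
    exact ⟨y, hy, a, b + q.length, by simp only [h1]; ring, h2⟩
  · exact zero_mem _

theorem span_range_ofPath : Submodule.span K (Set.range (ofPath K (n := n))) = ⊤ := by
  have := Finsupp.supported_eq_span_single K (Set.univ : Set (CPath n))
  rw [Finsupp.supported_univ, Set.image_univ] at this
  exact this.symm

/-- The ideal is monomial: the span of the zero paths is closed under multiplication on both sides,
hence contains the ideal; conversely a zero path factors through some y in Y. -/
theorem mem_relIdeal_iff_mem_span (a : PathAlgebra K n) :
    a ∈ relIdeal K Y ↔ a ∈ Submodule.span K (ofPath K '' {p | IsZeroPath Y p}) := by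
  set J := Submodule.span K (ofPath K '' {p | IsZeroPath Y p}) with hJ
  have hl : ∀ x y, y ∈ J → x * y ∈ J := by
    intro x y hy
    have h : mulHom K x y ∈ Submodule.map₂ (mulHom K) (⊤ : Submodule K (PathAlgebra K n)) J :=
      Submodule.apply_mem_map₂ _ trivial hy
    rw [← span_range_ofPath, hJ, Submodule.map₂_span_span] at h
    refine Submodule.span_le.2 ?_ h
    rintro _ ⟨_, ⟨p, rfl⟩, _, ⟨q, hq, rfl⟩, rfl⟩
    simp only [mulHom_ofPath]
    exact hq.pathMul_left K p
  have hr : ∀ x y, x ∈ J → x * y ∈ J := by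
    intro x y hx
    have h : mulHom K x y ∈ Submodule.map₂ (mulHom K) J (⊤ : Submodule K (PathAlgebra K n)) :=
      Submodule.apply_mem_map₂ _ hx trivial
    rw [← span_range_ofPath, hJ, Submodule.map₂_span_span] at h
    refine Submodule.span_le.2 ?_ h
    rintro _ ⟨_, ⟨q, hq, rfl⟩, _, ⟨p, rfl⟩, rfl⟩
    simp only [mulHom_ofPath]
    exact IsZeroPath.pathMul_right K hq p
  constructor
  · intro ha
    let I : TwoSidedIdeal (PathAlgebra K n) := .mk' (J : Set (PathAlgebra K n)) (zero_mem J)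
      (add_mem) (neg_mem) (hl _ _) (hr _ _)
    have hI : relIdeal K Y ≤ I := by
      refine TwoSidedIdeal.span_le.2 ?_
      rintro _ ⟨y, hy, rfl⟩
      simp only [I, SetLike.mem_coe, TwoSidedIdeal.mem_mk']
      exact Submodule.subset_span ⟨y, ⟨y, hy, 0, 0, by simp, by simp⟩, rfl⟩
    have := hI ha
    simpa only [I, SetLike.mem_coe, TwoSidedIdeal.mem_mk'] using this
  · intro ha
    induction ha using Submodule.span_induction with
    | mem x hx =>
      obtain ⟨p, ⟨y, hy, a, b, h1, h2⟩, rfl⟩ := hx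
      have hp : ofPath K p = ofPath K ⟨p.start, a⟩ * ofPath K y *
          ofPath K ⟨p.start + ((a + y.length : ℕ) : ZMod n), b⟩ := by
        rw [ofPath_mul, pathMul, if_pos, ofPath_mul, pathMul, if_pos, ← h1]
        · rfl
        · rw [CPath.target, h2]
      rw [hp]
      exact TwoSidedIdeal.mul_mem_right _ _ _ (TwoSidedIdeal.mul_mem_left _ _ _
        (TwoSidedIdeal.subset_span ⟨y, hy, rfl⟩))
    | zero => exact zero_mem _
    | add x y _ _ hx hy => exact add_mem hx hy
    -- A two-sided ideal is only closed under ring multiplication, so the scalar is absorbed as (t •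
    -- 1) * x.
    | smul t x _ hx =>
      rw [← one_mul x, ← smul_mul_assoc]
      exact TwoSidedIdeal.mul_mem_left _ _ _ hx

/-- The quotient map `KQ_n → Λ`. -/
noncomputable def toAlg : PathAlgebra K n →ₗ[K] Alg K Y where
  toFun := (relIdeal K Y).ringCon.mk'
  map_add' := map_add _
  map_smul' _ _ := rfl

theorem toAlg_surjective : Function.Surjective (toAlg K Y) := RingCon.mk'_surjective _

theorem ker_toAlg : LinearMap.ker (toAlg K Y) =
    Submodule.span K (ofPath K '' {p | IsZeroPath Y p}) := by
  ext a
  rw [← mem_relIdeal_iff_mem_span, LinearMap.mem_ker, TwoSidedIdeal.mem_iff, ← RingCon.eq]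
  rfl

/-- The class in `Λ` of the path of length `m` starting at `i`. -/
noncomputable def pathClass (i : ZMod n) (m : ℕ) : Alg K Y := toAlg K Y (ofPath K ⟨i, m⟩)

theorem sum_pathClass : ∑ i, pathClass K Y i 0 = 1 := by
  simp only [pathClass, ← map_sum, ← one_def]
  exact map_one (relIdeal K Y).ringCon.mk'

theorem pathClass_mul (i j : ZMod n) (m l : ℕ) :
    pathClass K Y i m * pathClass K Y j l =
      if i + (m : ZMod n) = j then pathClass K Y i (m + l) else 0 := by
  have h : pathClass K Y i m * pathClass K Y j l =
      toAlg K Y (ofPath K ⟨i, m⟩ * ofPath K ⟨j, l⟩) :=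
    (map_mul (relIdeal K Y).ringCon.mk' _ _).symm
  rw [h, ofPath_mul, pathMul]
  by_cases hij : i + (m : ZMod n) = j
  · rw [if_pos hij, if_pos (show CPath.target ⟨i, m⟩ = j from hij)]
    rfl
  · rw [if_neg hij, if_neg (show ¬ CPath.target ⟨i, m⟩ = j from hij)]
    exact map_zero _

variable {K Y}

theorem pathClass_mul_pathClass {i j : ZMod n} {m : ℕ} (h : i + (m : ZMod n) = j) (l : ℕ) :
    pathClass K Y i m * pathClass K Y j l = pathClass K Y i (m + l) := by
  rw [pathClass_mul, if_pos h]

theorem Alg.hom_ext {M : Type*} [AddCommMonoid M] [Module K M] {f g : Alg K Y →ₗ[K] M}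
    (h : ∀ i m, f (pathClass K Y i m) = g (pathClass K Y i m)) : f = g := by
  have : f ∘ₗ toAlg K Y = g ∘ₗ toAlg K Y := Nakayama.hom_ext K fun p => h p.start p.length
  ext a
  obtain ⟨a, rfl⟩ := toAlg_surjective K Y a
  exact LinearMap.congr_fun this a

variable (K)

theorem pathClass_eq_zero (hY : Y.Nonempty) {i : ZMod n} {m : ℕ} (h : kupisch Y i ≤ m) :
    pathClass K Y i m = 0 := by
  rw [pathClass, ← LinearMap.mem_ker, ker_toAlg]
  exact Submodule.subset_span ⟨_, (isZeroPath_iff hY).2 h, rfl⟩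

/-! ### Coordinates with respect to the basis of nonzero paths -/

theorem exists_coeff (hY : Y.Nonempty) (i : ZMod n) (m : ℕ) :
    ∃ f : Alg K Y →ₗ[K] K, ∀ j l, f (pathClass K Y j l) =
      if j = i ∧ l = m ∧ m < kupisch Y i then 1 else 0 := by
  by_cases hm : m < kupisch Y i
  · let ψ : PathAlgebra K n →ₗ[K] K := Finsupp.lapply (R := K) (M := K) (⟨i, m⟩ : CPath n)
    have hψ : ∀ j l, ψ (ofPath K ⟨j, l⟩) = if j = i ∧ l = m then 1 else 0 := fun j l => by
      classical
      refine Finsupp.single_apply.trans ?_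
      simp only [CPath.mk.injEq]
    -- The kernel is spanned by zero paths, and (i, m) is not one of them, so the coordinate
    -- descends to Λ. For m ≥ `kupisch Y i` the functional is 0 by convention.
    have hker : LinearMap.ker (toAlg K Y) ≤ LinearMap.ker ψ := by
      rw [ker_toAlg, Submodule.span_le]
      rintro _ ⟨⟨j, l⟩, hp, rfl⟩
      rw [SetLike.mem_coe, LinearMap.mem_ker, hψ, if_neg]
      rintro ⟨rfl, rfl⟩
      exact absurd ((isZeroPath_iff hY).1 hp) (by omega)
    let e := (toAlg K Y).quotKerEquivOfSurjective (toAlg_surjective K Y)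
    refine ⟨(LinearMap.ker (toAlg K Y)).liftQ ψ hker ∘ₗ e.symm.toLinearMap, fun j l => ?_⟩
    have he : e.symm (pathClass K Y j l) = Submodule.Quotient.mk (ofPath K ⟨j, l⟩) := by
      rw [LinearEquiv.symm_apply_eq]; rfl
    rw [LinearMap.comp_apply, LinearEquiv.coe_coe, he, Submodule.liftQ_apply, hψ]
    simp [hm]
  · exact ⟨0, fun j l => by simp [hm]⟩

/-- The coefficient at the path of length `m` starting at `i`. -/
noncomputable def coeff (hY : Y.Nonempty) (i : ZMod n) (m : ℕ) : Alg K Y →ₗ[K] K :=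
  (exists_coeff K hY i m).choose

variable (hY : Y.Nonempty)

theorem coeff_pathClass (i : ZMod n) (m : ℕ) (j : ZMod n) (l : ℕ) :
    coeff K hY i m (pathClass K Y j l) = if j = i ∧ l = m ∧ m < kupisch Y i then 1 else 0 :=
  (exists_coeff K hY i m).choose_spec j l

variable {K}

theorem coeff_pathClass_self {i : ZMod n} {m : ℕ} (h : m < kupisch Y i) :
    coeff K hY i m (pathClass K Y i m) = 1 := by
  rw [coeff_pathClass, if_pos ⟨rfl, rfl, h⟩]

theorem coeff_eq_zero_of_le {i : ZMod n} {m : ℕ} (h : kupisch Y i ≤ m) (a : Alg K Y) :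
    coeff K hY i m a = 0 := by
  have : coeff K hY i m = 0 := Alg.hom_ext fun j l => by
    rw [coeff_pathClass, if_neg (by omega), LinearMap.zero_apply]
  rw [this, LinearMap.zero_apply]

theorem eq_sum_coeff (a : Alg K Y) :
    a = ∑ i, ∑ m ∈ Finset.range (kupisch Y i), coeff K hY i m a • pathClass K Y i m := by
  have h : LinearMap.id = ∑ i, ∑ m ∈ Finset.range (kupisch Y i),
      (coeff K hY i m).smulRight (pathClass K Y i m) := by
    refine Alg.hom_ext fun j l => ?_
    simp only [LinearMap.id_apply, LinearMap.sum_apply, LinearMap.smulRight_apply,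
      coeff_pathClass]
    rw [Finset.sum_eq_single j]
    · by_cases hl : l < kupisch Y j
      · rw [Finset.sum_eq_single l]
        · simp [hl]
        · intro b _ hb
          rw [if_neg (by tauto), zero_smul]
        · intro h; exact absurd (Finset.mem_range.2 hl) h
      · rw [pathClass_eq_zero K hY (by omega), Finset.sum_eq_zero]
        intro b hb
        rw [if_neg (by rw [Finset.mem_range] at hb; omega), zero_smul]
    · intro b _ hb
      refine Finset.sum_eq_zero fun m _ => ?_
      rw [if_neg (by tauto), zero_smul]
    · simp
  have := LinearMap.congr_fun h a
  simpa only [LinearMap.id_apply, LinearMap.sum_apply, LinearMap.smulRight_apply] using this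

theorem coeff_pathClass_mul (hk : IsKupisch (kupisch Y)) (i j : ZMod n) (m l : ℕ) (a : Alg K Y) :
    coeff K hY j l (pathClass K Y i m * a) =
      if j = i ∧ m ≤ l ∧ l < kupisch Y i then coeff K hY (i + (m : ZMod n)) (l - m) a else 0 := by
  have h : coeff K hY j l ∘ₗ LinearMap.mulLeft K (pathClass K Y i m) =
      if j = i ∧ m ≤ l ∧ l < kupisch Y i then coeff K hY (i + (m : ZMod n)) (l - m) else 0 := by
    refine Alg.hom_ext fun i' m' => ?_
    rw [LinearMap.comp_apply, LinearMap.mulLeft_apply, pathClass_mul]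
    -- A final part of a nonzero path is nonzero: l < c(i) gives l - m < c(i+m), so the coefficient
    -- on the right is not the default 0.
    have h1 := hk.le_add i m
    split_ifs with h2 h3 h3
    · subst h2
      obtain ⟨rfl, h4, h5⟩ := h3
      rw [coeff_pathClass, coeff_pathClass]
      congr 1
      simp only [true_and, eq_iff_iff]
      constructor <;> rintro ⟨h6, h7⟩ <;> constructor <;> omega
    · rw [coeff_pathClass, if_neg, LinearMap.zero_apply]
      rintro ⟨rfl, rfl, h6⟩
      exact h3 ⟨rfl, by omega, h6⟩
    · rw [coeff_pathClass, if_neg (fun h => h2 h.1.symm), map_zero]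
    · simp
  have := LinearMap.congr_fun h a
  rw [LinearMap.comp_apply, LinearMap.mulLeft_apply] at this
  rw [this]
  split_ifs <;> rfl

theorem coeff_mul_pathClass (i j : ZMod n) (m l : ℕ) (a : Alg K Y) :
    coeff K hY j l (a * pathClass K Y i m) =
      if j + ((l - m : ℕ) : ZMod n) = i ∧ m ≤ l ∧ l < kupisch Y j then
        coeff K hY j (l - m) a else 0 := by
  have h : coeff K hY j l ∘ₗ LinearMap.mulRight K (pathClass K Y i m) =
      if j + ((l - m : ℕ) : ZMod n) = i ∧ m ≤ l ∧ l < kupisch Y j then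
        coeff K hY j (l - m) else 0 := by
    refine Alg.hom_ext fun i' m' => ?_
    rw [LinearMap.comp_apply, LinearMap.mulRight_apply, pathClass_mul]
    split_ifs with h2 h3 h3
    · obtain ⟨h3, h4, h5⟩ := h3
      rw [coeff_pathClass, coeff_pathClass]
      congr 1
      simp only [eq_iff_iff]
      constructor <;> rintro ⟨h6, h7⟩ <;> refine ⟨h6, ?_⟩ <;> omega
    · rw [coeff_pathClass, if_neg, LinearMap.zero_apply]
      rintro ⟨rfl, rfl, h6⟩
      exact h3 ⟨by simpa using h2, by omega, h6⟩
    · rw [coeff_pathClass, if_neg, map_zero]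
      rintro ⟨rfl, rfl, h6⟩
      exact h2 h3.1
    · simp
  have := LinearMap.congr_fun h a
  rw [LinearMap.comp_apply, LinearMap.mulRight_apply] at this
  rw [this]
  split_ifs <;> rfl

include hY in
theorem finite_alg : Module.Finite K (Alg K Y) := by
  classical
  refine ⟨⟨Finset.univ.biUnion fun i => (Finset.range (kupisch Y i)).image (pathClass K Y i), ?_⟩⟩
  rw [eq_top_iff]
  rintro a -
  rw [eq_sum_coeff hY a]
  refine sum_mem fun i _ => sum_mem fun m hm => Submodule.smul_mem _ _ (Submodule.subset_span ?_)
  simp only [Finset.coe_biUnion, Set.mem_iUnion, Finset.coe_image]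
  exact ⟨i, by simp, m, hm, rfl⟩

end Basis

/-! ### Right ideals generated by paths -/

section PathIdeal

open MulOpposite

variable (K : Type u) [Field K] {n : ℕ} [NeZero n] (Y : Set (CPath n))

/-- The right ideal generated by a path. -/
noncomputable def pathIdeal (i : ZMod n) (m : ℕ) : Submodule (Alg K Y)ᵐᵒᵖ (Alg K Y) :=
  Submodule.span (Alg K Y)ᵐᵒᵖ {pathClass K Y i m}

variable {K Y}

theorem mem_pathIdeal {i : ZMod n} {m : ℕ} {x : Alg K Y} :
    x ∈ pathIdeal K Y i m ↔ ∃ a, pathClass K Y i m * a = x := by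
  rw [pathIdeal, Submodule.mem_span_singleton]
  exact ⟨fun ⟨a, h⟩ => ⟨a.unop, h⟩, fun ⟨a, h⟩ => ⟨op a, h⟩⟩

theorem pathClass_mem_pathIdeal (i : ZMod n) {m l : ℕ} (h : m ≤ l) :
    pathClass K Y i l ∈ pathIdeal K Y i m :=
  mem_pathIdeal.2 ⟨pathClass K Y (i + (m : ZMod n)) (l - m), by
    rw [pathClass_mul_pathClass rfl, Nat.add_sub_cancel' h]⟩

theorem pathIdeal_antitone (i : ZMod n) : Antitone (pathIdeal K Y i) := fun _ _ h =>
  Submodule.span_le.2 (Set.singleton_subset_iff.2 (pathClass_mem_pathIdeal i h))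

theorem mul_mem_of_mem {L : Submodule (Alg K Y)ᵐᵒᵖ (Alg K Y)} {x : Alg K Y} (hx : x ∈ L)
    (a : Alg K Y) : x * a ∈ L := L.smul_mem (op a) hx

theorem smul_mem_of_mem {L : Submodule (Alg K Y)ᵐᵒᵖ (Alg K Y)} {x : Alg K Y} (hx : x ∈ L)
    (t : K) : t • x ∈ L := by
  rw [← mul_one x, ← mul_smul_comm]
  exact mul_mem_of_mem hx _

theorem pathClass_zero_mul_eq {i : ZMod n} {m : ℕ} {x : Alg K Y} (hx : x ∈ pathIdeal K Y i m) :
    pathClass K Y i 0 * x = x := by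
  obtain ⟨a, rfl⟩ := mem_pathIdeal.1 hx
  rw [← mul_assoc, pathClass_mul_pathClass (by simp), zero_add]

section Coeff

variable (hY : Y.Nonempty) (hk : IsKupisch (kupisch Y))
include hk

theorem mem_pathIdeal_iff {i : ZMod n} {m : ℕ} {x : Alg K Y} :
    x ∈ pathIdeal K Y i m ↔ ∀ j l, ¬(j = i ∧ m ≤ l) → coeff K hY j l x = 0 := by
  constructor
  · intro hx j l h
    obtain ⟨a, rfl⟩ := mem_pathIdeal.1 hx
    rw [coeff_pathClass_mul hY hk, if_neg (by tauto)]
  · intro h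
    rw [eq_sum_coeff hY x]
    refine sum_mem fun j _ => sum_mem fun l _ => ?_
    by_cases hjl : j = i ∧ m ≤ l
    · obtain ⟨rfl, hl⟩ := hjl
      exact smul_mem_of_mem (pathClass_mem_pathIdeal j hl) _
    · rw [h j l hjl, zero_smul]
      exact zero_mem _

include hY in
theorem pathIdeal_le_iff {i : ZMod n} {m l : ℕ} (h : l < kupisch Y i) :
    pathIdeal K Y i l ≤ pathIdeal K Y i m ↔ m ≤ l := by
  refine ⟨fun h1 => ?_, fun h1 => pathIdeal_antitone i h1⟩
  by_contra h2
  have := (mem_pathIdeal_iff hY hk).1 (h1 (pathClass_mem_pathIdeal i le_rfl)) i l (by tauto)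
  rw [coeff_pathClass_self hY h] at this
  exact one_ne_zero this

omit hk in
include hY in
theorem pathIdeal_eq_bot {i : ZMod n} {m : ℕ} (h : kupisch Y i ≤ m) : pathIdeal K Y i m = ⊥ := by
  rw [pathIdeal, pathClass_eq_zero K hY h, Submodule.span_zero_singleton]

/-- The submodule generated by an element of `P_i` contains the paths from its lowest term on. -/
theorem pathIdeal_le_of_mem {i : ZMod n} {m : ℕ} {x : Alg K Y}
    {L : Submodule (Alg K Y)ᵐᵒᵖ (Alg K Y)} (hxL : x ∈ L) (hx : x ∈ pathIdeal K Y i m)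
    (h0 : coeff K hY i m x ≠ 0) : pathIdeal K Y i m ≤ L := by
  -- Downward induction on l, with d bounding the distance to the length at which all paths vanish.
  have key : ∀ d l, m ≤ l → kupisch Y i ≤ l + d → pathIdeal K Y i l ≤ L := by
    intro d
    induction d with
    | zero =>
      intro l _ h2
      rw [pathIdeal_eq_bot hY (by omega)]; exact bot_le
    | succ d ih =>
      intro l h1 h2
      by_cases hl : kupisch Y i ≤ l
      · rw [pathIdeal_eq_bot hY hl]; exact bot_le
      refine Submodule.span_le.2 (Set.singleton_subset_iff.2 ?_)
      -- Right multiplication by this path moves the lowest term of x from length m to length l. The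
      -- remaining terms of b are longer than l and lie in L by induction.
      set b := x * pathClass K Y (i + (m : ZMod n)) (l - m) with hb
      have hbL : b ∈ L := mul_mem_of_mem hxL _
      have hcoef : ∀ j k, coeff K hY j k b = if j = i ∧ l ≤ k ∧ k < kupisch Y i ∧
          i + ((k - (l - m) : ℕ) : ZMod n) = i + (m : ZMod n) then
            coeff K hY i (k - (l - m)) x else 0 := by
        intro j k
        rw [hb, coeff_mul_pathClass]
        by_cases hj : j = i
        · subst hj
          by_cases hlk : l ≤ k
          · refine if_congr ?_ rfl rfl
            constructor
            · rintro ⟨h3, h4, h5⟩; exact ⟨rfl, hlk, h5, h3⟩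
            · rintro ⟨-, -, h3, h4⟩; exact ⟨h4, by omega, h3⟩
          · rw [if_neg (by tauto : ¬(j = j ∧ l ≤ k ∧ _))]
            split_ifs with h3
            · exact (mem_pathIdeal_iff hY hk).1 hx _ _ (by omega)
            · rfl
        · rw [if_neg (by tauto : ¬(j = i ∧ l ≤ k ∧ _))]
          split_ifs with h3
          · exact (mem_pathIdeal_iff hY hk).1 hx _ _ (by tauto)
          · rfl
      have ht : coeff K hY i l b = coeff K hY i m x := by
        have h3 : l - (l - m) = m := by omega
        rw [hcoef, h3, if_pos ⟨rfl, le_rfl, by omega, rfl⟩]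
      have hr : b - coeff K hY i m x • pathClass K Y i l ∈ pathIdeal K Y i (l + 1) := by
        refine (mem_pathIdeal_iff hY hk).2 fun j k hjk => ?_
        rw [map_sub, map_smul, coeff_pathClass, smul_eq_mul]
        by_cases h3 : i = j ∧ l = k
        · obtain ⟨rfl, rfl⟩ := h3
          rw [ht, if_pos ⟨rfl, rfl, by omega⟩]; ring
        · rw [hcoef, if_neg, if_neg (by tauto)]; · ring
          rintro ⟨rfl, h4, h5, h6⟩
          have h7 : l ≠ k := fun h => h3 ⟨rfl, h⟩
          exact hjk ⟨rfl, by omega⟩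
      have hrL := ih (l + 1) (by omega) (by omega) hr
      have h4 : pathClass K Y i l = (coeff K hY i m x)⁻¹ •
          (b - (b - coeff K hY i m x • pathClass K Y i l)) := by
        rw [sub_sub_cancel, smul_smul, inv_mul_cancel₀ h0, one_smul]
      rw [SetLike.mem_coe, h4]
      exact smul_mem_of_mem (sub_mem hbL hrL) _
  exact key (kupisch Y i) m le_rfl (by omega)

include hY in
/-- `P_i` is uniserial. -/
theorem exists_eq_pathIdeal {i : ZMod n} {L : Submodule (Alg K Y)ᵐᵒᵖ (Alg K Y)}
    (hL : L ≤ pathIdeal K Y i 0) : ∃ m ≤ kupisch Y i, L = pathIdeal K Y i m := by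
  by_cases h : ∃ m, ∃ x ∈ L, coeff K hY i m x ≠ 0
  · classical
    -- The element x realises the smallest length of a path occurring in any element of L.
    obtain ⟨x, hx, hne⟩ := Nat.find_spec h
    have hle : L ≤ pathIdeal K Y i (Nat.find h) := by
      intro z hz
      refine (mem_pathIdeal_iff hY hk).2 fun j l hjl => ?_
      by_contra h1
      have h2 : j = i := by
        by_contra h2
        exact h1 ((mem_pathIdeal_iff hY hk).1 (hL hz) j l (by tauto))
      subst h2
      exact Nat.find_min h (m := l) (by by_contra h2; exact hjl ⟨rfl, by omega⟩) ⟨z, hz, h1⟩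
    refine ⟨Nat.find h, ?_, hle.antisymm (pathIdeal_le_of_mem hY hk hx (hle hx) hne)⟩
    by_contra h1
    exact hne (coeff_eq_zero_of_le hY (by omega) x)
  · push Not at h
    refine ⟨kupisch Y i, le_rfl, ?_⟩
    rw [pathIdeal_eq_bot hY le_rfl, eq_bot_iff]
    intro z hz
    have : z ∈ pathIdeal K Y i (kupisch Y i) := by
      refine (mem_pathIdeal_iff hY hk).2 fun j l hjl => ?_
      by_cases h2 : j = i
      · subst h2; exact h l z hz
      · exact (mem_pathIdeal_iff hY hk).1 (hL hz) j l (by tauto)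
    rwa [pathIdeal_eq_bot hY le_rfl] at this

end Coeff

/-! ### Submodules of `P_i` -/

variable (K Y) in
/-- The right ideal generated by a path, as a submodule of the projective module at the starting
vertex. -/
noncomputable def pathSub (i : ZMod n) (m : ℕ) : Submodule (Alg K Y)ᵐᵒᵖ (proj K Y i) :=
  (pathIdeal K Y i m).submoduleOf (proj K Y i)

theorem mem_pathSub {i : ZMod n} {m : ℕ} {x : proj K Y i} :
    x ∈ pathSub K Y i m ↔ (x : Alg K Y) ∈ pathIdeal K Y i m := Iff.rfl

theorem pathIdeal_le_proj (i : ZMod n) (m : ℕ) : pathIdeal K Y i m ≤ proj K Y i :=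
  pathIdeal_antitone i (Nat.zero_le m)

/-- The right ideal generated by a path does not depend on the ambient module. -/
noncomputable def pathSubEquiv (i : ZMod n) (m : ℕ) :
    pathSub K Y i m ≃ₗ[(Alg K Y)ᵐᵒᵖ] pathIdeal K Y i m :=
  Submodule.submoduleOfEquivOfLe (pathIdeal_le_proj i m)

variable (hY : Y.Nonempty) (hk : IsKupisch (kupisch Y))

theorem map_pathSub (i : ZMod n) (m : ℕ) :
    (pathSub K Y i m).map (proj K Y i).subtype = pathIdeal K Y i m := by
  rw [pathSub, Submodule.submoduleOf, Submodule.map_comap_subtype]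
  exact inf_eq_right.2 (pathIdeal_le_proj i m)

theorem pathSub_antitone (i : ZMod n) : Antitone (pathSub K Y i) := fun _ _ h =>
  Submodule.comap_mono (pathIdeal_antitone i h)

include hY hk in
theorem pathSub_le_iff {i : ZMod n} {m l : ℕ} (h : l < kupisch Y i) :
    pathSub K Y i l ≤ pathSub K Y i m ↔ m ≤ l := by
  refine ⟨fun h1 => (pathIdeal_le_iff hY hk h (K := K)).1 ?_, fun h1 => pathSub_antitone i h1⟩
  rw [← map_pathSub, ← map_pathSub]
  exact Submodule.map_mono h1

include hY hk in
theorem exists_eq_pathSub {i : ZMod n} (L : Submodule (Alg K Y)ᵐᵒᵖ (proj K Y i)) :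
    ∃ m ≤ kupisch Y i, L = pathSub K Y i m := by
  obtain ⟨m, hm, h⟩ := exists_eq_pathIdeal hY hk (i := i) (Submodule.map_subtype_le _ L)
  refine ⟨m, hm, Submodule.map_injective_of_injective (proj K Y i).injective_subtype ?_⟩
  rw [h, map_pathSub]

include hY hk in
theorem pathSub_le_iff_of_le {i : ZMod n} {m l : ℕ} (hm : m ≤ kupisch Y i) (hl : l ≤ kupisch Y i) :
    pathSub K Y i l ≤ pathSub K Y i m ↔ m ≤ l := by
  rcases hl.lt_or_eq with h | h
  · exact pathSub_le_iff hY hk h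
  · exact ⟨fun _ => h ▸ hm, fun h => pathSub_antitone i h⟩

/-- The submodule lattice of `P_i` is a chain of length `|P_i|`. -/
noncomputable def pathSubOrderIso (i : ZMod n) :
    (Fin (kupisch Y i + 1))ᵒᵈ ≃o Submodule (Alg K Y)ᵐᵒᵖ (proj K Y i) where
  toEquiv := Equiv.ofBijective (fun m => pathSub K Y i (OrderDual.ofDual m : Fin _))
    ⟨fun a b h => by
      have h1 := (pathSub_le_iff_of_le hY hk (K := K) (OrderDual.ofDual b).is_le
        (OrderDual.ofDual a).is_le).1 h.le
      have h2 := (pathSub_le_iff_of_le hY hk (K := K) (OrderDual.ofDual a).is_le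
        (OrderDual.ofDual b).is_le).1 h.ge
      exact congrArg OrderDual.toDual (Fin.ext (le_antisymm h2 h1)),
    fun L => by
      obtain ⟨m, hm, rfl⟩ := exists_eq_pathSub hY hk L
      exact ⟨OrderDual.toDual ⟨m, by omega⟩, rfl⟩⟩
  map_rel_iff' {a b} := by
    refine (pathSub_le_iff_of_le hY hk (K := K) (OrderDual.ofDual b).is_le
        (OrderDual.ofDual a).is_le).trans ?_
    rfl

/-! ### Length, radical and socle of P_i -/

theorem krullDim_fin_succ (m : ℕ) : Order.krullDim (Fin (m + 1)) = m := by
  refine le_antisymm (iSup_le fun p => ?_) (le_iSup_of_le (LTSeries.mk m id strictMono_id) le_rfl)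
  have := Fintype.card_le_of_injective p p.strictMono.injective
  simp only [Fintype.card_fin] at this
  exact_mod_cast Nat.le_of_succ_le_succ this

include hY hk in
theorem projLength_eq (i : ZMod n) : projLength K Y i = kupisch Y i := by
  have h : Module.length (Alg K Y)ᵐᵒᵖ (proj K Y i) = (kupisch Y i : ℕ∞) := by
    apply WithBot.coe_injective
    rw [Module.coe_length, ← Order.krullDim_eq_of_orderIso (pathSubOrderIso hY hk i),
      Order.krullDim_orderDual, krullDim_fin_succ]
    rfl
  rw [projLength, h]; rfl

include hY hk in
theorem pathSub_eq_bot_iff {i : ZMod n} {m : ℕ} : pathSub K Y i m = ⊥ ↔ kupisch Y i ≤ m := by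
  have h0 : pathSub K Y i (kupisch Y i) = ⊥ := by
    rw [pathSub, pathIdeal_eq_bot hY le_rfl]
    exact (Submodule.eq_bot_iff _).2 fun x hx => Subtype.ext ((Submodule.mem_bot (M := Alg K Y) (Alg K Y)ᵐᵒᵖ).1 hx)
  constructor
  · intro h
    by_contra h1
    have h2 : pathSub K Y i m ≤ pathSub K Y i (kupisch Y i) := by rw [h]; exact bot_le
    have := (pathSub_le_iff hY hk (by omega)).1 h2
    omega
  · intro h
    rw [eq_bot_iff, ← h0]
    exact pathSub_antitone i h

theorem pathSub_zero (i : ZMod n) : pathSub K Y i 0 = ⊤ := by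
  rw [eq_top_iff]; exact fun x _ => x.2

include hY hk in
theorem isCoatom_iff {i : ZMod n} (L : Submodule (Alg K Y)ᵐᵒᵖ (proj K Y i)) :
    IsCoatom L ↔ L = pathSub K Y i 1 := by
  have hp := hk.pos i
  have h1 : pathSub K Y i 1 ≠ ⊤ := by
    intro h
    have := (pathSub_le_iff_of_le hY hk (K := K) hp (Nat.zero_le _)).1 (by rw [h]; exact le_top)
    omega
  have h2 : ∀ L : Submodule (Alg K Y)ᵐᵒᵖ (proj K Y i), L ≠ ⊤ → L ≤ pathSub K Y i 1 := by
    intro L hL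
    obtain ⟨m, hm, rfl⟩ := exists_eq_pathSub hY hk L
    refine pathSub_antitone i ?_
    by_contra h
    obtain rfl : m = 0 := by omega
    exact hL (pathSub_zero i)
  constructor
  · intro h
    rcases (h2 L h.1).lt_or_eq with h3 | h3
    · exact absurd (h.2 _ h3) h1
    · exact h3
  · rintro rfl
    refine ⟨h1, fun L' h3 => ?_⟩
    by_contra h4
    exact absurd (h2 L' h4) h3.not_ge

include hY hk in
theorem jacobson_proj (i : ZMod n) :
    Module.jacobson (Alg K Y)ᵐᵒᵖ (proj K Y i) = pathSub K Y i 1 := by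
  rw [Module.jacobson]
  have : {m : Submodule (Alg K Y)ᵐᵒᵖ (proj K Y i) | IsCoatom m} = {pathSub K Y i 1} := by
    ext L; exact isCoatom_iff hY hk L
  rw [this, sInf_singleton]

include hY hk in
theorem isSimple_iff {i : ZMod n} (L : Submodule (Alg K Y)ᵐᵒᵖ (proj K Y i)) :
    IsSimpleModule (Alg K Y)ᵐᵒᵖ L ↔ L = pathSub K Y i (kupisch Y i - 1) := by
  have hp := hk.pos i
  rw [isSimpleModule_iff_isAtom]
  have h1 : pathSub K Y i (kupisch Y i - 1) ≠ ⊥ := by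
    rw [Ne, pathSub_eq_bot_iff hY hk]; omega
  have h2 : ∀ L : Submodule (Alg K Y)ᵐᵒᵖ (proj K Y i), L ≠ ⊥ →
      pathSub K Y i (kupisch Y i - 1) ≤ L := by
    intro L hL
    obtain ⟨m, hm, rfl⟩ := exists_eq_pathSub hY hk L
    refine pathSub_antitone i ?_
    rw [Ne, pathSub_eq_bot_iff hY hk] at hL
    omega
  constructor
  · intro h
    rcases (h2 L h.1).lt_or_eq with h3 | h3
    · exact absurd (h.2 _ h3) h1
    · exact h3.symm
  · rintro rfl
    refine ⟨h1, fun L' h3 => ?_⟩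
    by_contra h4
    exact absurd (h2 L' h4) h3.not_ge

include hY hk in
theorem socle_proj (i : ZMod n) :
    socle (Alg K Y)ᵐᵒᵖ (proj K Y i) = pathSub K Y i (kupisch Y i - 1) := by
  have : {N : Submodule (Alg K Y)ᵐᵒᵖ (proj K Y i) | IsSimpleModule (Alg K Y)ᵐᵒᵖ N} =
      {pathSub K Y i (kupisch Y i - 1)} := by
    ext L; exact isSimple_iff hY hk L
  rw [socle, this, sSup_singleton]

/-! ### Left multiplication by a path -/

variable (K Y) in
/-- Left multiplication by a path, as a map from the projective module at its end to the right ideal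
that it generates. -/
noncomputable def pathMulLeft (i : ZMod n) (m : ℕ) :
    proj K Y (i + (m : ZMod n)) →ₗ[(Alg K Y)ᵐᵒᵖ] pathIdeal K Y i m where
  toFun x := ⟨pathClass K Y i m * x, mem_pathIdeal.2 ⟨_, rfl⟩⟩
  map_add' _ _ := Subtype.ext (mul_add _ _ _)
  map_smul' _ _ := Subtype.ext (mul_assoc _ _ _).symm

theorem pathMulLeft_surjective (i : ZMod n) (m : ℕ) :
    Function.Surjective (pathMulLeft K Y i m) := by
  rintro ⟨x, hx⟩
  obtain ⟨a, rfl⟩ := mem_pathIdeal.1 hx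
  refine ⟨⟨pathClass K Y (i + (m : ZMod n)) 0 * a, mem_pathIdeal.2 ⟨a, rfl⟩⟩, Subtype.ext ?_⟩
  change pathClass K Y i m * (pathClass K Y (i + (m : ZMod n)) 0 * a) = _
  rw [← mul_assoc, pathClass_mul_pathClass rfl, add_zero]

-- A path of length l starting at i+m is killed exactly when m + l ≥ c(i). This is the
-- module-theoretic source of `syz`.
include hY hk in
theorem ker_pathMulLeft (i : ZMod n) (m : ℕ) :
    LinearMap.ker (pathMulLeft K Y i m) =
      pathSub K Y (i + (m : ZMod n)) (kupisch Y i - m) := by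
  ext ⟨x, hx⟩
  rw [LinearMap.mem_ker, mem_pathSub]
  have h1 : pathMulLeft K Y i m ⟨x, hx⟩ = 0 ↔ pathClass K Y i m * x = 0 := by
    rw [← Submodule.coe_eq_zero]; rfl
  rw [h1]
  have hx' : x ∈ pathIdeal K Y (i + (m : ZMod n)) 0 := hx
  constructor
  · intro h
    refine (mem_pathIdeal_iff hY hk).2 fun j l hjl => ?_
    by_cases hj : j = i + (m : ZMod n)
    · subst hj
      have hl : ¬ kupisch Y i - m ≤ l := fun h => hjl ⟨rfl, h⟩
      have h2 := coeff_pathClass_mul hY hk i i m (m + l) x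
      rw [h, map_zero, if_pos ⟨rfl, by omega, by omega⟩, Nat.add_sub_cancel_left] at h2
      exact h2.symm
    · exact (mem_pathIdeal_iff hY hk).1 hx' j l (by tauto)
  · intro h
    obtain ⟨a, rfl⟩ := mem_pathIdeal.1 h
    rw [← mul_assoc, pathClass_mul_pathClass rfl, pathClass_eq_zero K hY (by omega), zero_mul]

/-- The simple module at `i` is the quotient of `P_i` by the paths of positive length. -/
noncomputable def simpleModEquiv (i : ZMod n) :
    simpleMod K Y i ≃ₗ[(Alg K Y)ᵐᵒᵖ] proj K Y i ⧸ pathSub K Y i 1 :=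
  Submodule.quotEquivOfEq _ _ (jacobson_proj hY hk i)

-- The idempotent e_i fixes the generator of S_i but annihilates S_j for j ≠ i.
include hY hk in
theorem simpleMod_eq_of_equiv {i j : ZMod n}
    (e : simpleMod K Y i ≃ₗ[(Alg K Y)ᵐᵒᵖ] simpleMod K Y j) : i = j := by
  by_contra hij
  let e' := (simpleModEquiv hY hk i).symm.trans (e.trans (simpleModEquiv hY hk j))
  let u : proj K Y i := ⟨pathClass K Y i 0, pathClass_mem_pathIdeal i le_rfl⟩
  have hu : op (pathClass K Y i 0) • u = u := Subtype.ext (by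
    change pathClass K Y i 0 * pathClass K Y i 0 = pathClass K Y i 0
    rw [pathClass_mul_pathClass (by simp)])
  have h0 : ∀ v : proj K Y j ⧸ pathSub K Y j 1, op (pathClass K Y i 0) • v = 0 := by
    intro v
    obtain ⟨⟨x, hx⟩, rfl⟩ := Submodule.Quotient.mk_surjective _ v
    rw [← Submodule.Quotient.mk_smul, Submodule.Quotient.mk_eq_zero, mem_pathSub]
    change x * pathClass K Y i 0 ∈ _
    refine (mem_pathIdeal_iff hY hk).2 fun k l hkl => ?_
    rw [coeff_mul_pathClass]
    split_ifs with h
    · refine (mem_pathIdeal_iff hY hk).1 (show x ∈ pathIdeal K Y j 0 from hx) _ _ ?_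
      rintro ⟨rfl, -⟩
      obtain rfl : l = 0 := by
        by_contra hl
        exact hkl ⟨rfl, by omega⟩
      exact hij (by simpa using h.1.symm)
    · rfl
  have h1 : e' (Submodule.Quotient.mk u) = 0 := by
    rw [← hu, Submodule.Quotient.mk_smul, map_smul, h0]
  rw [LinearEquiv.map_eq_zero_iff, Submodule.Quotient.mk_eq_zero, mem_pathSub] at h1
  have h2 := (mem_pathIdeal_iff hY hk).1 h1 i 0 (by omega)
  rw [coeff_pathClass_self hY (hk.pos i)] at h2
  exact one_ne_zero h2

/-- The right ideal generated by the longest nonzero path starting at `i` is simple. -/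
noncomputable def pathIdealEquivSimpleMod (i : ZMod n) :
    pathIdeal K Y i (kupisch Y i - 1) ≃ₗ[(Alg K Y)ᵐᵒᵖ]
      simpleMod K Y (i + ((kupisch Y i - 1 : ℕ) : ZMod n)) :=
  have h : LinearMap.ker (pathMulLeft K Y i (kupisch Y i - 1)) =
      pathSub K Y (i + ((kupisch Y i - 1 : ℕ) : ZMod n)) 1 := by
    have := hk.pos i
    rw [ker_pathMulLeft hY hk]
    congr 1; omega
  (((pathMulLeft K Y i (kupisch Y i - 1)).quotKerEquivOfSurjective
    (pathMulLeft_surjective i _)).symm.trans (Submodule.quotEquivOfEq _ _ h)).trans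
      (simpleModEquiv hY hk _).symm

include hY hk in
/-- The arrows of the resolution quiver are `i → i + |P_i|`. -/
theorem isArrow_iff (i j : ZMod n) : IsArrow K Y i j ↔ j = nextVertex (kupisch Y) i := by
  let e : socle (Alg K Y)ᵐᵒᵖ (proj K Y i) ≃ₗ[(Alg K Y)ᵐᵒᵖ]
      simpleMod K Y (i + ((kupisch Y i - 1 : ℕ) : ZMod n)) :=
    ((LinearEquiv.ofEq _ _ (socle_proj hY hk i)).trans (pathSubEquiv i _)).trans
      (pathIdealEquivSimpleMod hY hk i)
  -- The socle is spanned by the longest nonzero path, of length c(i) - 1. This accounts for the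
  -- shift to j - 1 in `IsArrow`.
  have h : i + ((kupisch Y i - 1 : ℕ) : ZMod n) = nextVertex (kupisch Y) i - 1 := by
    rw [nextVertex, Nat.cast_sub (hk.pos i)]; push_cast; ring
  rw [h] at e
  constructor
  · rintro ⟨e'⟩
    have := simpleMod_eq_of_equiv hY hk (e'.symm.trans e)
    exact sub_left_injective this
  · rintro rfl
    exact ⟨e⟩

end PathIdeal

/-! ### Projective dimension of modules -/

section ProjectiveDimension

variable {R : Type u} [Ring R]

theorem hasProjectiveDimensionLE_succ_iff_ker {P B : Type u} [AddCommGroup P] [Module R P]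
    [AddCommGroup B] [Module R B] [Module.Projective R P] {f : P →ₗ[R] B}
    (hf : Function.Surjective f) (d : ℕ) :
    HasProjectiveDimensionLE (ModuleCat.of R B) (d + 1) ↔
      HasProjectiveDimensionLE (ModuleCat.of R (LinearMap.ker f)) d :=
  (LinearMap.shortExact_shortComplexKer hf).hasProjectiveDimensionLT_X₃_iff d
    ((IsProjective.iff_projective P).1 inferInstance)

theorem hasProjectiveDimensionLE_iff_of_equiv {M N : Type u} [AddCommGroup M] [Module R M]
    [AddCommGroup N] [Module R N] (e : M ≃ₗ[R] N) (d : ℕ) :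
    HasProjectiveDimensionLE (ModuleCat.of R M) d ↔
      HasProjectiveDimensionLE (ModuleCat.of R N) d :=
  ⟨fun _ => hasProjectiveDimensionLT_of_iso e.toModuleIso _,
    fun _ => hasProjectiveDimensionLT_of_iso e.symm.toModuleIso _⟩

theorem hasProjectiveDimensionLE_zero_iff (M : Type u) [AddCommGroup M] [Module R M] :
    HasProjectiveDimensionLE (ModuleCat.of R M) 0 ↔ Module.Projective R M := by
  rw [← projective_iff_hasProjectiveDimensionLE_zero, IsProjective.iff_projective]

theorem HasProjectiveDimensionLE.mono {M : ModuleCat.{u} R} {d e : ℕ}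
    (h : HasProjectiveDimensionLE M d) (hde : d ≤ e) : HasProjectiveDimensionLE M e :=
  hasProjectiveDimensionLT_of_ge M (d + 1) (e + 1) (by omega)

theorem hasProjectiveDimensionLE_succ_of_exact {A P B : Type u} [AddCommGroup A] [Module R A]
    [AddCommGroup P] [Module R P] [AddCommGroup B] [Module R B] [Module.Projective R P]
    {g : A →ₗ[R] P} {f : P →ₗ[R] B} (hg : Function.Injective g)
    (hgf : LinearMap.range g = LinearMap.ker f) (hf : Function.Surjective f) {d : ℕ}
    (h : HasProjectiveDimensionLE (ModuleCat.of R A) d) :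
    HasProjectiveDimensionLE (ModuleCat.of R B) (d + 1) := by
  rwa [hasProjectiveDimensionLE_succ_iff_ker hf, ← hasProjectiveDimensionLE_iff_of_equiv
    ((LinearEquiv.ofInjective g hg).trans (LinearEquiv.ofEq _ _ hgf))]

theorem exists_presentation (M : Type u) [AddCommGroup M] [Module R M] :
    ∃ (A P : ModuleCat.{u} R) (g : A →ₗ[R] P) (f : P →ₗ[R] M), Module.Projective R P ∧
      Function.Injective g ∧ LinearMap.range g = LinearMap.ker f ∧ Function.Surjective f := by
  let f : (M →₀ R) →ₗ[R] M := Finsupp.linearCombination R id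
  exact ⟨ModuleCat.of R (LinearMap.ker f), ModuleCat.of R (M →₀ R), (LinearMap.ker f).subtype, f,
    inferInstanceAs (Module.Projective R (M →₀ R)), Subtype.val_injective,
    Submodule.range_subtype _, Finsupp.linearCombination_id_surjective R M⟩

/-- The projective dimension of a direct sum is bounded by a bound for the summands. -/
theorem hasProjectiveDimensionLE_dfinsupp {ι : Type u} {M : ι → Type u}
    [∀ i, AddCommGroup (M i)] [∀ i, Module R (M i)] {d : ℕ}
    (h : ∀ i, HasProjectiveDimensionLE (ModuleCat.of R (M i)) d) :
    HasProjectiveDimensionLE (ModuleCat.of R (Π₀ i, M i)) d := by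
  induction d generalizing M with
  | zero =>
    simp only [hasProjectiveDimensionLE_zero_iff] at h ⊢
    infer_instance
  | succ d ih =>
    -- Dimension shifting: the direct sum of presentations of the summands presents the direct sum.
    choose A P g f hP hg hgf hf using fun i => exists_presentation (R := R) (M i)
    let F : (Π₀ i, P i) →ₗ[R] Π₀ i, M i := DFinsupp.mapRange.linearMap f
    have hF : Function.Surjective F :=
      (DFinsupp.mapRange_surjective (fun i => f i) fun i => map_zero (f i)).2 hf
    let G : (Π₀ i, A i) →ₗ[R] Π₀ i, P i := DFinsupp.mapRange.linearMap g
    have hG : Function.Injective G :=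
      (DFinsupp.mapRange_injective (fun i => g i) fun i => map_zero (g i)).2 hg
    have hGF : LinearMap.range G = LinearMap.ker F := by
      rw [DFinsupp.range_mapRangeLinearMap, DFinsupp.ker_mapRangeLinearMap]
      simp only [hgf]
    refine hasProjectiveDimensionLE_succ_of_exact (A := Π₀ i, A i) (P := Π₀ i, P i)
      (B := Π₀ i, M i) (g := G) (f := F) hG hGF hF (ih fun i => ?_)
    have h1 := (hasProjectiveDimensionLE_succ_iff_ker (hf i) d).1 (h i)
    rwa [← hasProjectiveDimensionLE_iff_of_equiv
      ((LinearEquiv.ofInjective (g i) (hg i)).trans (LinearEquiv.ofEq _ _ (hgf i)))] at h1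

/-- Over a semiprimary ring, a common bound for the projective dimensions of the simple modules is a
bound for the projective dimensions of all modules. -/
theorem hasProjectiveDimensionLE_of_simple [IsSemiprimaryRing R] {d : ℕ}
    (h : ∀ (S : Type u) [AddCommGroup S] [Module R S] [IsSimpleModule R S],
      HasProjectiveDimensionLE (ModuleCat.of R S) d) (M : ModuleCat.{u} R) :
    HasProjectiveDimensionLE M d := by
  -- It suffices to treat semisimple modules, which are direct sums of simple ones, and to check
  -- that the bound passes to extensions.
  refine IsSemiprimaryRing.induction R R M
    (P := fun M => HasProjectiveDimensionLE (ModuleCat.of R M) d) ?_ ?_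
  · intro M _ _ _ _ _ _
    obtain ⟨s, e, -, hs⟩ := IsSemisimpleModule.exists_linearEquiv_dfinsupp R M
    rw [hasProjectiveDimensionLE_iff_of_equiv e]
    exact hasProjectiveDimensionLE_dfinsupp fun m => h _
  · intro M _ _ _ _ N h1 h2
    have hS := LinearMap.shortExact_shortComplexKer (Submodule.mkQ_surjective N)
    refine hS.hasProjectiveDimensionLT_X₂ (d + 1) ?_ h2
    exact (hasProjectiveDimensionLE_iff_of_equiv (LinearEquiv.ofEq _ _ N.ker_mkQ) d).2 h1

end ProjectiveDimension

/-! ### Global dimension of Nakayama algebras -/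

section GlobalDimension

open MulOpposite

variable {K : Type u} [Field K] {n : ℕ} [NeZero n] {Y : Set (CPath n)}

/-- Left multiplication by e_i is a retraction of the free module Λ onto e_iΛ. -/
instance (i : ZMod n) : Module.Projective (Alg K Y)ᵐᵒᵖ (proj K Y i) := by
  let e : (Alg K Y)ᵐᵒᵖ ≃ₗ[(Alg K Y)ᵐᵒᵖ] Alg K Y :=
    { (opAddEquiv (α := Alg K Y)).symm with map_smul' := fun _ _ => rfl }
  have : Module.Projective (Alg K Y)ᵐᵒᵖ (Alg K Y) := .of_equiv e
  let s : Alg K Y →ₗ[(Alg K Y)ᵐᵒᵖ] proj K Y i :=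
    { toFun := fun x => ⟨pathClass K Y i 0 * x, mem_pathIdeal.2 ⟨x, rfl⟩⟩
      map_add' := fun _ _ => Subtype.ext (mul_add _ _ _)
      map_smul' := fun _ _ => Subtype.ext (mul_assoc _ _ _).symm }
  refine Module.Projective.of_split (proj K Y i).subtype s (LinearMap.ext fun x => Subtype.ext ?_)
  exact pathClass_zero_mul_eq x.2

variable (hY : Y.Nonempty) (hk : IsKupisch (kupisch Y))
include hY hk

/-- This also covers a path that vanishes in Λ: its ideal is 0, and the kernel is the whole
projective, of length parameter 0. -/
theorem hasProjectiveDimensionLE_pathIdeal_succ_iff (p : ZMod n × ℕ) (d : ℕ) :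
    HasProjectiveDimensionLE (ModuleCat.of (Alg K Y)ᵐᵒᵖ (pathIdeal K Y p.1 p.2)) (d + 1) ↔
      HasProjectiveDimensionLE (ModuleCat.of (Alg K Y)ᵐᵒᵖ
        (pathIdeal K Y (syz (kupisch Y) p).1 (syz (kupisch Y) p).2)) d := by
  rw [hasProjectiveDimensionLE_succ_iff_ker (pathMulLeft_surjective (K := K) p.1 p.2)]
  exact hasProjectiveDimensionLE_iff_of_equiv
    ((LinearEquiv.ofEq _ _ (ker_pathMulLeft (K := K) hY hk p.1 p.2)).trans (pathSubEquiv _ _)) d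

theorem hasProjectiveDimensionLE_simpleMod_succ_iff (i : ZMod n) (d : ℕ) :
    HasProjectiveDimensionLE (ModuleCat.of (Alg K Y)ᵐᵒᵖ (simpleMod K Y i)) (d + 1) ↔
      HasProjectiveDimensionLE (ModuleCat.of (Alg K Y)ᵐᵒᵖ (pathIdeal K Y i 1)) d := by
  rw [hasProjectiveDimensionLE_succ_iff_ker (Submodule.mkQ_surjective _)]
  exact hasProjectiveDimensionLE_iff_of_equiv
    ((LinearEquiv.ofEq _ _ ((Submodule.ker_mkQ _).trans (jacobson_proj (K := K) hY hk i))).trans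
      (pathSubEquiv _ _)) d

/-- A right ideal generated by a path is projective only if it is zero or its projective cover is an
isomorphism. -/
theorem eq_of_projective_pathIdeal {i : ZMod n} {m : ℕ}
    (h : Module.Projective (Alg K Y)ᵐᵒᵖ (pathIdeal K Y i m)) :
    kupisch Y i ≤ m ∨ kupisch Y (i + (m : ZMod n)) ≤ kupisch Y i - m := by
  by_contra! hlt
  obtain ⟨hm, hl⟩ := hlt
  obtain ⟨s, hs⟩ := Module.projective_lifting_property (pathMulLeft K Y i m) LinearMap.id
    (pathMulLeft_surjective i m)
  let p : pathIdeal K Y i m := ⟨pathClass K Y i m, pathClass_mem_pathIdeal i le_rfl⟩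
  -- The path q kills the generator p, hence also its image under the section s. But s(p) has
  -- coefficient 1 at the trivial path, so s(p) * q has coefficient 1 at q, which is nonzero by
  -- `hl`.
  let q : Alg K Y := pathClass K Y (i + (m : ZMod n)) (kupisch Y i - m)
  have h1 : pathClass K Y i m * (s p : Alg K Y) = pathClass K Y i m :=
    congrArg Subtype.val (LinearMap.congr_fun hs p)
  have h2 : op q • p = 0 := Subtype.ext (by
    change pathClass K Y i m * q = 0
    rw [pathClass_mul_pathClass rfl, pathClass_eq_zero K hY (by omega)])
  have h3 : (s p : Alg K Y) * q = 0 := by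
    have h4 : op q • s p = 0 := by rw [← map_smul, h2, map_zero]
    exact congrArg Subtype.val h4
  have h5 := coeff_pathClass_mul hY hk i i m m (s p : Alg K Y)
  rw [h1, coeff_pathClass_self hY hm, if_pos ⟨rfl, le_rfl, hm⟩, Nat.sub_self] at h5
  have h6 := coeff_mul_pathClass hY (i + (m : ZMod n)) (i + (m : ZMod n)) (kupisch Y i - m)
    (kupisch Y i - m) (s p : Alg K Y)
  rw [h3, map_zero, if_pos ⟨by simp, le_rfl, hl⟩, Nat.sub_self, ← h5] at h6
  exact zero_ne_one h6

theorem exists_syz_iterate_of_hasProjectiveDimensionLE {d : ℕ} {p : ZMod n × ℕ}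
    (hp : p.2 ≤ kupisch Y p.1)
    (h : HasProjectiveDimensionLE (ModuleCat.of (Alg K Y)ᵐᵒᵖ (pathIdeal K Y p.1 p.2)) d) :
    ∃ k, ((syz (kupisch Y))^[k] p).2 = 0 := by
  induction d generalizing p with
  | zero =>
    rw [hasProjectiveDimensionLE_zero_iff] at h
    -- A zero ideal has a full projective as its kernel, reaching length 0 in one step; if the cover
    -- is an isomorphism, the kernel is zero and one more step is needed.
    rcases eq_of_projective_pathIdeal hY hk h with h | h
    · exact ⟨1, by simp [syz, h]⟩
    · exact ⟨2, by simp [syz, h]⟩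
  | succ d ih =>
    rw [hasProjectiveDimensionLE_pathIdeal_succ_iff hY hk] at h
    have := hk.le_add p.1 p.2
    obtain ⟨k, hk'⟩ := ih (by simp only [syz]; omega) h
    exact ⟨k + 1, hk'⟩

theorem hasProjectiveDimensionLE_of_syz_iterate {k : ℕ} {p : ZMod n × ℕ}
    (h : ((syz (kupisch Y))^[k] p).2 = 0) :
    HasProjectiveDimensionLE (ModuleCat.of (Alg K Y)ᵐᵒᵖ (pathIdeal K Y p.1 p.2)) k := by
  induction k generalizing p with
  | zero =>
    obtain ⟨i, m⟩ := p
    obtain rfl : m = 0 := h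
    rw [hasProjectiveDimensionLE_zero_iff]
    exact inferInstanceAs (Module.Projective (Alg K Y)ᵐᵒᵖ (proj K Y i))
  | succ k ih =>
    rw [hasProjectiveDimensionLE_pathIdeal_succ_iff hY hk]
    exact ih h

/-- Every simple module is the top of an indecomposable projective module. -/
theorem exists_equiv_simpleMod (S : Type u) [AddCommGroup S] [Module (Alg K Y)ᵐᵒᵖ S]
    [IsSimpleModule (Alg K Y)ᵐᵒᵖ S] : ∃ i, Nonempty (simpleMod K Y i ≃ₗ[(Alg K Y)ᵐᵒᵖ] S) := by
  have := IsSimpleModule.nontrivial (Alg K Y)ᵐᵒᵖ S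
  obtain ⟨m, hm⟩ := exists_ne (0 : S)
  have hne : ∃ l, ∃ j, op (pathClass K Y j l) • m ≠ 0 := by
    by_contra! h
    apply hm
    rw [← one_smul (Alg K Y)ᵐᵒᵖ m, ← op_one, ← sum_pathClass, Finset.op_sum, Finset.sum_smul]
    exact Finset.sum_eq_zero fun i _ => h 0 i
  -- With l maximal, m times a suitable path of length l is nonzero and killed by every arrow. It
  -- defines a nonzero map from the projective at the end of that path which kills the radical.
  obtain ⟨l, ⟨j, hj⟩, hmax⟩ : ∃ l, (∃ j, op (pathClass K Y j l) • m ≠ 0) ∧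
      ∀ j, op (pathClass K Y j (l + 1)) • m = 0 := by
    by_contra! h
    have hall : ∀ d, ∃ l ≥ d, ∃ j, op (pathClass K Y j l) • m ≠ 0 := by
      intro d
      induction d with
      | zero => obtain ⟨l, hl⟩ := hne; exact ⟨l, Nat.zero_le _, hl⟩
      | succ d ih =>
        obtain ⟨l, hl, hl'⟩ := ih
        exact ⟨l + 1, by omega, h l hl'⟩
    obtain ⟨l, hl, j, hj⟩ := hall (∑ i, kupisch Y i)
    have h1 : kupisch Y j ≤ ∑ i, kupisch Y i :=
      Finset.single_le_sum (fun _ _ => Nat.zero_le _) (Finset.mem_univ j)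
    rw [pathClass_eq_zero K hY (h1.trans hl), op_zero, zero_smul] at hj
    exact hj rfl
  let i : ZMod n := j + (l : ZMod n)
  let φ : proj K Y i →ₗ[(Alg K Y)ᵐᵒᵖ] S :=
    { toFun := fun x => op (x : Alg K Y) • op (pathClass K Y j l) • m
      map_add' := fun x y => by rw [Submodule.coe_add, MulOpposite.op_add, add_smul]
      map_smul' := fun a x => by
        rw [RingHom.id_apply, ← mul_smul a]
        rfl }
  have hφ : φ ⟨pathClass K Y i 0, pathClass_mem_pathIdeal i le_rfl⟩ ≠ 0 := by
    change op (pathClass K Y i 0) • op (pathClass K Y j l) • m ≠ 0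
    rwa [← mul_smul, ← op_mul, pathClass_mul_pathClass rfl, add_zero]
  have hle : pathSub K Y i 1 ≤ LinearMap.ker φ := by
    rintro ⟨x, hx⟩ hx1
    obtain ⟨a, rfl⟩ := mem_pathIdeal.1 (mem_pathSub.1 hx1)
    change op (pathClass K Y i 1 * a) • op (pathClass K Y j l) • m = 0
    rw [op_mul, mul_smul, ← mul_smul (op (pathClass K Y i 1)), ← op_mul,
      pathClass_mul_pathClass rfl, hmax, smul_zero]
  have hker : LinearMap.ker φ = pathSub K Y i 1 := by
    rcases hle.lt_or_eq with h | h
    · have := ((isCoatom_iff hY hk _).2 rfl).2 _ h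
      exact absurd (LinearMap.congr_fun (LinearMap.ker_eq_top.1 this) _) hφ
    · exact h.symm
  have hsurj : Function.Surjective φ := by
    refine (LinearMap.surjective_or_eq_zero φ).resolve_right fun h => hφ ?_
    rw [h]; rfl
  exact ⟨i, ⟨(Submodule.quotEquivOfEq _ _ ((jacobson_proj hY hk i).trans hker.symm)).trans
    (φ.quotKerEquivOfSurjective hsurj)⟩⟩

variable (K) in
/-- Finite global dimension in terms of the Kupisch series. -/
theorem hasFiniteGlobalDimension_iff :
    HasFiniteGlobalDimension (Alg K Y)ᵐᵒᵖ ↔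
      ∀ i, ∃ k, ((syz (kupisch Y))^[k] (i, 1)).2 = 0 := by
  constructor
  · rintro ⟨d, hd⟩ i
    -- Weakening d to d + 1 leaves the bound d after passing from S_i to the radical of P_i.
    have h := HasProjectiveDimensionLE.mono (hd (ModuleCat.of _ (simpleMod K Y i))) d.le_succ
    rw [hasProjectiveDimensionLE_simpleMod_succ_iff hY hk] at h
    exact exists_syz_iterate_of_hasProjectiveDimensionLE hY hk (p := (i, 1)) (hk.pos i) h
  · intro h
    choose k hk' using h
    have := finite_alg (K := K) hY
    have : IsArtinianRing (Alg K Y)ᵐᵒᵖ := IsArtinianRing.of_finite K _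
    -- The sum bounds all k i at once; the extra 1 is the step from the radical of P_i to S_i.
    refine ⟨∑ i, k i + 1, hasProjectiveDimensionLE_of_simple fun S _ _ _ => ?_⟩
    obtain ⟨i, ⟨e⟩⟩ := exists_equiv_simpleMod (K := K) hY hk S
    rw [← hasProjectiveDimensionLE_iff_of_equiv e,
      hasProjectiveDimensionLE_simpleMod_succ_iff hY hk]
    exact HasProjectiveDimensionLE.mono
      (hasProjectiveDimensionLE_of_syz_iterate hY hk (p := (i, 1)) (hk' i))
      (Finset.single_le_sum (fun _ _ => Nat.zero_le _) (Finset.mem_univ i))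

end GlobalDimension

/-! ### Components and cycles of the resolution quiver -/

section ResolutionQuiver

open Function

variable {K : Type u} [Field K] {n : ℕ} [NeZero n] {Y : Set (CPath n)}

theorem componentOf_iterate (hY : Y.Nonempty) (hk : IsKupisch (kupisch Y)) (i : ZMod n) (k : ℕ) :
    componentOf K Y ((nextVertex (kupisch Y))^[k] i) = componentOf K Y i := by
  induction k with
  | zero => rfl
  | succ k ih =>
    rw [iterate_succ_apply', ← ih]
    refine ((Quiver.WeaklyConnectedComponent.eq (V := ResolutionQuiver Y K) _ _).2
      ⟨Quiver.Hom.toPath (Sum.inl ⟨?_⟩)⟩).symm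
    exact (isArrow_iff hY hk _ _).2 rfl

/-- Each vertex has exactly one outgoing arrow, so a zigzag of arrows can be folded into two forward
orbits that meet. -/
theorem componentOf_eq_iff (hY : Y.Nonempty) (hk : IsKupisch (kupisch Y)) (i j : ZMod n) :
    componentOf K Y i = componentOf K Y j ↔
      ∃ k l, (nextVertex (kupisch Y))^[k] i = (nextVertex (kupisch Y))^[l] j := by
  constructor
  · intro h
    obtain ⟨p⟩ := (Quiver.WeaklyConnectedComponent.eq (V := ResolutionQuiver Y K) _ _).1 h
    induction p with
    | nil => exact ⟨0, 0, rfl⟩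
    | cons p e ih =>
      rename_i b c
      obtain ⟨k, l, hkl⟩ := ih ((Quiver.WeaklyConnectedComponent.eq (V := ResolutionQuiver Y K)
        _ _).2 ⟨p⟩)
      rcases e with ⟨⟨e⟩⟩ | ⟨⟨e⟩⟩
      · refine ⟨k + 1, l, ?_⟩
        rw [(isArrow_iff hY hk _ _).1 e, iterate_succ_apply', hkl]
        exact (iterate_succ_apply' _ _ _).symm
      · refine ⟨k, l + 1, ?_⟩
        rw [hkl, (isArrow_iff hY hk _ _).1 e]
        rfl
  · rintro ⟨k, l, h⟩
    rw [← componentOf_iterate hY hk i k, h, componentOf_iterate hY hk]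

theorem isOrientedCycle_periodicOrbit (hY : Y.Nonempty) (hk : IsKupisch (kupisch Y)) {i : ZMod n}
    (hi : i ∈ periodicPts (nextVertex (kupisch Y))) :
    IsOrientedCycle K Y (periodicOrbit (nextVertex (kupisch Y)) i) := by
  refine ⟨fun h => periodicOrbit_eq_nil_iff_not_periodic_pt.1 h hi, nodup_periodicOrbit, ?_⟩
  rw [periodicOrbit_chain]
  intro m _
  rw [isArrow_iff hY hk, iterate_succ_apply']

theorem eq_map_iterate_of_isChain {α : Type*} {f : α → α} {a : α} {t : List α}
    (h : List.IsChain (fun x y => y = f x) (a :: t)) :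
    a :: t = (List.range (t.length + 1)).map fun k => f^[k] a := by
  induction t generalizing a with
  | nil => rfl
  | cons b t ih =>
    rw [List.isChain_cons_cons] at h
    obtain ⟨rfl, h⟩ := h
    rw [ih h, List.length_map, List.length_range, List.range_succ_eq_map (n := t.length + 1),
      List.map_cons, List.map_map]
    rfl

theorem eq_periodicOrbit_of_chain {α : Type*} {f : α → α} {c : Cycle α} (hc : c ≠ Cycle.nil)
    (hd : c.Nodup) (h : c.Chain fun x y => y = f x) :
    ∃ a ∈ periodicPts f, c = periodicOrbit f a := by
  induction c using Cycle.induction_on with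
  | nil => exact absurd rfl hc
  | cons a l _ =>
    rw [Cycle.chain_coe_cons] at h
    have h1 := eq_map_iterate_of_isChain h
    rw [List.length_append, List.length_singleton, List.range_succ, List.map_append,
      ← List.cons_append] at h1
    -- The last entry of the closed-up chain says that a returns to itself after `l.length + 1`
    -- steps; distinctness of the vertices then excludes a smaller period.
    obtain ⟨h2, h3⟩ := List.append_inj' h1 (by simp)
    have hper : IsPeriodicPt f (l.length + 1) a := by
      rw [List.map_singleton, List.singleton_inj] at h3
      exact h3.symm
    have hmem := mk_mem_periodicPts (Nat.succ_pos _) hper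
    have hmin : minimalPeriod f a = l.length + 1 := by
      refine (hper.minimalPeriod_le (Nat.succ_pos _)).antisymm ?_
      by_contra! hlt
      rw [Cycle.nodup_coe_iff, h2, List.nodup_map_iff_inj_on List.nodup_range] at hd
      have := hd 0 (by simp) _ (List.mem_range.2 hlt) (by simp)
      exact (minimalPeriod_pos_of_mem_periodicPts hmem).ne this
    refine ⟨a, hmem, ?_⟩
    rw [periodicOrbit_def, hmin, ← h2]

theorem cycleWeight_periodicOrbit (hY : Y.Nonempty) (hk : IsKupisch (kupisch Y)) (i : ZMod n) :
    cycleWeight K Y (periodicOrbit (nextVertex (kupisch Y)) i) =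
      ((∑ j ∈ Finset.range (minimalPeriod (nextVertex (kupisch Y)) i),
        kupisch Y ((nextVertex (kupisch Y))^[j] i) : ℕ) : ℚ) / n := by
  have h : projLength K Y = kupisch Y := funext (projLength_eq hY hk)
  rw [cycleWeight, h, periodicOrbit_def, Cycle.coe_toMultiset, Multiset.map_coe, List.map_map,
    Multiset.sum_coe]
  rfl

theorem connected_and_hasWeight_iff (hY : Y.Nonempty) (hk : IsKupisch (kupisch Y)) :
    (Nat.card (Component K Y) = 1 ∧ ∀ C : Component K Y, HasWeight K Y C 1) ↔
      (∀ i j, ∃ k l, (nextVertex (kupisch Y))^[k] i = (nextVertex (kupisch Y))^[l] j) ∧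
      ∀ i ∈ periodicPts (nextVertex (kupisch Y)),
        ∑ j ∈ Finset.range (minimalPeriod (nextVertex (kupisch Y)) i),
          kupisch Y ((nextVertex (kupisch Y))^[j] i) = n := by
  have hn : (n : ℚ) ≠ 0 := Nat.cast_ne_zero.2 (NeZero.ne n)
  rw [Nat.card_eq_one_iff_unique]
  constructor
  · rintro ⟨⟨hs, -⟩, hw⟩
    refine ⟨fun i j => (componentOf_eq_iff hY hk (K := K) i j).1 (Subsingleton.elim _ _),
      fun i hi => ?_⟩
    have h := (hw (componentOf K Y i)).2 _ (isOrientedCycle_periodicOrbit hY hk hi)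
      fun _ _ => Subsingleton.elim _ _
    rw [cycleWeight_periodicOrbit hY hk, div_eq_one_iff_eq hn] at h
    exact_mod_cast h
  · rintro ⟨hconn, hw⟩
    have hs : Subsingleton (Component K Y) := ⟨fun a b => by
      induction a using Quotient.inductionOn
      induction b using Quotient.inductionOn
      exact (componentOf_eq_iff hY hk _ _).2 (hconn _ _)⟩
    refine ⟨⟨hs, ⟨componentOf K Y 0⟩⟩, fun C => ⟨?_, ?_⟩⟩
    · obtain ⟨k, hk'⟩ := exists_iterate_mem_periodicPts (nextVertex (kupisch Y)) 0
      exact ⟨_, isOrientedCycle_periodicOrbit hY hk hk', fun _ _ => Subsingleton.elim _ _⟩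
    · rintro c ⟨h1, h2, h3⟩ -
      obtain ⟨a, ha, rfl⟩ := eq_periodicOrbit_of_chain h1 h2
        (h3.imp fun i j h => (isArrow_iff hY hk i j).1 h)
      rw [cycleWeight_periodicOrbit hY hk, hw a ha, div_self hn]

end ResolutionQuiver

/-! ### Truncated path algebras -/

section Truncated

variable {n : ℕ}

theorem kupisch_truncated [NeZero n] (l : ℕ) (i : ZMod n) : kupisch {p : CPath n | p.length = l} i = l := by
  refine le_antisymm (Nat.sInf_le ⟨⟨i, l⟩, rfl, 0, 0, by simp, by simp⟩) ?_
  obtain ⟨y, hy, a, b, h, -⟩ := (isZeroPath_iff (Y := {p : CPath n | p.length = l})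
    ⟨⟨i, l⟩, rfl⟩ (i := i)).2 le_rfl
  simp only [Set.mem_ofPred_eq] at hy h
  omega

/-- Here `syz` acts on lengths by m ↦ l - m, which swaps 1 and l - 1. Neither is 0, so the syzygy
sequence never terminates. -/
theorem syz_iterate_truncated {l : ℕ} (hl : 2 ≤ l) (i : ZMod n) (k : ℕ) :
    ((syz fun _ : ZMod n => l)^[k] (i, 1)).2 = 1 ∨
      ((syz fun _ : ZMod n => l)^[k] (i, 1)).2 = l - 1 := by
  induction k with
  | zero => exact Or.inl rfl
  | succ k ih =>
    rw [Function.iterate_succ_apply']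
    simp only [syz]
    omega

end Truncated

end Nakayama

/-! ### Conclusion -/

theorem theoremA {K : Type u} [Field K] {n : ℕ} [NeZero n] :
    (∀ Y : Set (Nakayama.CPath n), Y.Finite → Y.Nonempty → (∀ y ∈ Y, 1 ≤ y.length) →
      (Nakayama.HasFiniteGlobalDimension (Nakayama.Alg K Y)ᵐᵒᵖ ↔
        Nat.card (Nakayama.Component K Y) = 1 ∧
          ∀ C : Nakayama.Component K Y, Nakayama.HasWeight K Y C 1)) ∧
    (∀ l : ℕ, 1 ≤ l →
      (Nakayama.HasFiniteGlobalDimension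
          (Nakayama.Alg K {p : Nakayama.CPath n | p.length = l})ᵐᵒᵖ ↔ l = 1)) := by
  refine ⟨fun Y _ hY hpos => ?_, fun l hl => ?_⟩
  · have hk := Nakayama.isKupisch_kupisch hY hpos
    rw [Nakayama.hasFiniteGlobalDimension_iff K hY hk, hk.forall_exists_syz_iff,
      Nakayama.connected_and_hasWeight_iff hY hk]
  · have hY : {p : Nakayama.CPath n | p.length = l}.Nonempty := ⟨⟨0, l⟩, rfl⟩
    have hk := Nakayama.isKupisch_kupisch hY fun y hy => hl.trans_eq (Eq.symm hy)
    rw [Nakayama.hasFiniteGlobalDimension_iff K hY hk, funext (Nakayama.kupisch_truncated l)]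
    constructor
    · intro h
      by_contra hne
      obtain ⟨k, h⟩ := h 0
      have := Nakayama.syz_iterate_truncated (n := n) (show 2 ≤ l by omega) 0 k
      omega
    · rintro rfl i
      -- For l = 1 the pair (i, 1) stands for the zero ideal, and one syzygy has length 1 - 1 = 0.
      exact ⟨1, rfl⟩
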